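/- Let $\Sigma$ be a compact connected oriented surface of genus $g$ with boundary components $\zeta_1,\dots,\zeta_b$ ($b\ge 0$), hyperbolic in the sense that $2-2g-b<0$. Let $\xi_1,\dots,\xi_m$ be pairwise disjoint, non-isotopic essential simple closed curves in $\Sigma$ that divide $\Sigma$ into hyperbolic subsurfaces $\Sigma_1,\dots,\Sigma_l$ (the components of $\Sigma\setminus\bigcup_k\xi_k$). Put $G=\mathrm{PSL}_n(\mathbb R)$, $\mathfrak g=\mathfrak{sl}_n(\mathbb R)$, $\Gamma=\pi_1(\Sigma)$, $\Gamma_{\Sigma_i}=\pi_1(\Sigma_i)$, and let $\iota_{\Sigma_i}\colon\Gamma_{\Sigma_i}\to\Gamma$ be induced by the inclusion and a path between the base points. For a group $\Lambda$, a family $\mathcal S$ of subgroups and a homomorphism $\rho\colon\Lambda\to G$, let $\mathfrak g_\rho$ be $\mathfrak g$ with the action $\operatorname{Ad}\circ\rho$, and let $H^1_{\mathrm{par}}(\Lambda,\mathcal S;\mathfrak g_\rho)\subset H^1(\Lambda;\mathfrak g_\rho)$ be the subspace of the classes that restrict to $0$ on every subgroup in $\mathcal S$. For a compact oriented hyperbolic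 surface $F$ with boundary components $\zeta_1,\dots,\zeta_b$, carrying the boundary orientation, choose a positively oriented standard presentation $$\Lambda=\pi_1(F)=\langle x_1,y_1,\dots,x_g,y_g,z_1,\dots,z_b\mid R\rangle,\qquad R=\prod_{i=1}^g[x_i,y_i]\prod_{j=1}^b z_j,$$ where $z_j$ represents $\zeta_j$. For $[\alpha],[\beta]\in H^1_{\mathrm{par}}(\Lambda,\{\langle z_j\rangle\};\mathfrak g_\rho)$ choose $X_j\in\mathfrak g$ with $\alpha(\gamma)=\gamma\cdot X_j-X_j$ for $\gamma\in\langle z_j\rangle$ and set $$\omega^F_K([\alpha],[\beta])=-\sum_{s}\operatorname{Tr}\,\alpha\Big(\overline{\tfrac{\partial R}{\partial s}}\Big)\beta(s)-\sum_{j=1}^b\operatorname{Tr}X_j\,\beta(z_j),$$ where $s$ runs over the generators $x_i,y_i,z_j$, $\partial R/\partial s$ is the Fox derivative, cochains are extended linearly to the group ring, and $\overline{\gamma}=\gamma^{-1}$. Choose conjugacy classes $B_j$ ($1\le j\le b$) and $C_k$ ($1\le k\le m$) in $G$. Let $\rho\colon\Gamma\to G$ be irreducible with trivial centralizer, with $\rho(\zeta_j)\in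 B_j$ and $\rho(\xi_k)\in C_k$ for all $j,k$, and suppose that each restriction $\rho_{\Gamma_{\Sigma_i}}=\rho\circ\iota_{\Sigma_i}$ is irreducible with trivial centralizer. Let $\mathcal S=\{\langle\xi_1\rangle,\dots,\langle\xi_m\rangle,\langle\zeta_1\rangle,\dots,\langle\zeta_b\rangle\}$, and let $\mathcal S_i$ consist of the subgroups of $\Gamma_{\Sigma_i}$ generated by the boundary components of the completion $\overline{\Sigma_i}$ of $\Sigma_i$. Then for all $[\alpha],[\beta]\in H^1_{\mathrm{par}}(\Gamma,\mathcal S;\mathfrak g_\rho)$ the classes $\iota^*_{\Sigma_i}[\alpha],\iota^*_{\Sigma_i}[\beta]$ lie in $H^1_{\mathrm{par}}(\Gamma_{\Sigma_i},\mathcal S_i;\mathfrak g_{\rho_{\Gamma_{\Sigma_i}}})$, and $$\omega^\Sigma_K([\alpha],[\beta])=\sum_{i=1}^l\omega^{\Sigma_i}_K\big(\iota^*_{\Sigma_i}[\alpha],\iota^*_{\Sigma_i}[\beta]\big).$$ -/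

import Mathlib

open scoped MatrixGroups Manifold ContDiff

noncomputable section

/-! ### The adjoint module -/

/-- Conjugation by `A ∈ SL_n(ℝ)` on `sl_n(ℝ)`. -/
def slConj (n : ℕ) (A : SL(n, ℝ)) :
    LieAlgebra.SpecialLinear.sl (Fin n) ℝ →ₗ[ℝ] LieAlgebra.SpecialLinear.sl (Fin n) ℝ where
  toFun X := ⟨(A : Matrix (Fin n) (Fin n) ℝ) * X.1 * ((A⁻¹ : SL(n, ℝ)) : Matrix (Fin n) (Fin n) ℝ), by
    have h : ((A⁻¹ : SL(n, ℝ)) : Matrix (Fin n) (Fin n) ℝ) * (A : Matrix (Fin n) (Fin n) ℝ) = 1 := by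
      rw [← Matrix.SpecialLinearGroup.coe_mul, inv_mul_cancel, Matrix.SpecialLinearGroup.coe_one]
    have hX : Matrix.trace X.1 = 0 := X.2
    have : Matrix.trace ((A : Matrix (Fin n) (Fin n) ℝ) * X.1 *
        ((A⁻¹ : SL(n, ℝ)) : Matrix (Fin n) (Fin n) ℝ)) = 0 := by
      rw [Matrix.trace_mul_comm, ← mul_assoc, h, one_mul, hX]
    exact this⟩
  map_add' X Y := Subtype.ext (by simp [mul_add, add_mul])
  map_smul' c X := Subtype.ext (by simp)

/-- The adjoint representation of `PSL_n(ℝ)` on `sl_n(ℝ)`, induced by conjugation in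
`SL_n(ℝ)`. -/
def adRep (n : ℕ) : Representation ℝ PSL(n, ℝ) (LieAlgebra.SpecialLinear.sl (Fin n) ℝ) :=
  QuotientGroup.lift (Subgroup.center SL(n, ℝ))
    { toFun := slConj n
      map_one' := by ext X : 2; simp [slConj]
      map_mul' := fun A B => by
        ext X : 2
        simp only [slConj, LinearMap.coe_mk, AddHom.coe_mk, Module.End.mul_apply, mul_inv_rev,
          Matrix.SpecialLinearGroup.coe_mul, mul_assoc] }
    (by
      intro A hA
      obtain ⟨r, -, hr⟩ := Matrix.SpecialLinearGroup.mem_center_iff.1 hA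
      rw [MonoidHom.mem_ker]
      ext X : 2
      have h : (A : Matrix (Fin n) (Fin n) ℝ) * ((A⁻¹ : SL(n, ℝ)) : Matrix (Fin n) (Fin n) ℝ)
          = 1 := by
        rw [← Matrix.SpecialLinearGroup.coe_mul, mul_inv_cancel, Matrix.SpecialLinearGroup.coe_one]
      have hc : (A : Matrix (Fin n) (Fin n) ℝ) * X.1 = X.1 * (A : Matrix (Fin n) (Fin n) ℝ) := by
        rw [← hr]; exact (Matrix.scalar_commute r (fun r' => mul_comm _ _) X.1).eq
      change (A : Matrix (Fin n) (Fin n) ℝ) * X.1 *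
        ((A⁻¹ : SL(n, ℝ)) : Matrix (Fin n) (Fin n) ℝ) = X.1
      rw [hc, mul_assoc, h, mul_one])

/-- The invariant form `(X, Y) ↦ Tr (X Y)` on `sl_n(ℝ)`. -/
def trForm (n : ℕ) : LinearMap.BilinForm ℝ (LieAlgebra.SpecialLinear.sl (Fin n) ℝ) :=
  LinearMap.mk₂ ℝ (fun X Y => Matrix.trace (X.1 * Y.1))
    (fun X X' Y => by simp [add_mul]) (fun c X Y => by simp)
    (fun X Y Y' => by simp [mul_add]) (fun c X Y => by simp)

theorem trForm_adRep (n : ℕ) (g : PSL(n, ℝ)) (X Y : LieAlgebra.SpecialLinear.sl (Fin n) ℝ) :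
    trForm n (adRep n g X) (adRep n g Y) = trForm n X Y := by
  induction g using QuotientGroup.induction_on with
  | H A =>
    have h : ((A⁻¹ : SL(n, ℝ)) : Matrix (Fin n) (Fin n) ℝ) * (A : Matrix (Fin n) (Fin n) ℝ) = 1 := by
      rw [← Matrix.SpecialLinearGroup.coe_mul, inv_mul_cancel, Matrix.SpecialLinearGroup.coe_one]
    change Matrix.trace (((A : Matrix (Fin n) (Fin n) ℝ) * X.1 *
      ((A⁻¹ : SL(n, ℝ)) : Matrix (Fin n) (Fin n) ℝ)) * ((A : Matrix (Fin n) (Fin n) ℝ) * Y.1 *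
      ((A⁻¹ : SL(n, ℝ)) : Matrix (Fin n) (Fin n) ℝ))) = Matrix.trace (X.1 * Y.1)
    rw [Matrix.trace_mul_comm, ← mul_assoc]
    rw [show (A : Matrix (Fin n) (Fin n) ℝ) * Y.1 * ((A⁻¹ : SL(n, ℝ)) : Matrix (Fin n) (Fin n) ℝ) *
      ((A : Matrix (Fin n) (Fin n) ℝ) * X.1) = (A : Matrix (Fin n) (Fin n) ℝ) * (Y.1 *
      ((((A⁻¹ : SL(n, ℝ)) : Matrix (Fin n) (Fin n) ℝ) * (A : Matrix (Fin n) (Fin n) ℝ)) * X.1)) by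
        simp only [mul_assoc]]
    rw [h, one_mul, Matrix.trace_mul_comm, ← mul_assoc, h, one_mul, Matrix.trace_mul_comm]

/-- The `Γ`-module `sl_n(ℝ)` with the action `Ad ∘ ρ`. -/
abbrev adModule {n : ℕ} {Γ : Type} [Group Γ] (ρ : Γ →* PSL(n, ℝ)) : Rep ℝ Γ :=
  Rep.of ((adRep n).comp ρ)

/-! ### Fox calculus -/

/-- Left multiplication of a group on the additive group of its integral group ring. -/
def groupRingAction (F : Type) [Group F] :
    F →* MulAut (Multiplicative (MonoidAlgebra ℤ F)) where
  toFun u :=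
    { toFun := fun r => Multiplicative.ofAdd (MonoidAlgebra.of ℤ F u * r.toAdd)
      invFun := fun r => Multiplicative.ofAdd (MonoidAlgebra.of ℤ F u⁻¹ * r.toAdd)
      left_inv := fun r => by
        simp only [toAdd_ofAdd, ← mul_assoc, ← map_mul, inv_mul_cancel, map_one, one_mul, ofAdd_toAdd]
      right_inv := fun r => by
        simp only [toAdd_ofAdd, ← mul_assoc, ← map_mul, mul_inv_cancel, map_one, one_mul, ofAdd_toAdd]
      map_mul' := fun r r' => by simp only [toAdd_mul, mul_add, ofAdd_add] }
  map_one' := by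
    ext r : 1
    simp only [MulEquiv.coe_mk, Equiv.coe_fn_mk, map_one, one_mul, ofAdd_toAdd, MulAut.one_apply]
  map_mul' u w := by ext r : 1; simp only [MulEquiv.coe_mk, Equiv.coe_fn_mk, map_mul, MulAut.mul_apply, toAdd_ofAdd, mul_assoc]

open Classical in
/-- The homomorphism `w ↦ (∂w/∂s, w)` into `ℤF ⋊ F` that sends a free generator `t` to
`(1, s)` if `t = s` and to `(0, t)` otherwise. -/
def foxHom {I : Type} (s : I) : FreeGroup I →*
    Multiplicative (MonoidAlgebra ℤ (FreeGroup I)) ⋊[groupRingAction (FreeGroup I)] FreeGroup I :=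
  FreeGroup.lift fun t =>
    ⟨Multiplicative.ofAdd (if t = s then 1 else 0), FreeGroup.of t⟩

/-- The Fox derivative `∂w/∂s ∈ ℤF` of an element `w` of the free group `F` on `I`. -/
def foxDeriv {I : Type} (s : I) (w : FreeGroup I) : MonoidAlgebra ℤ (FreeGroup I) :=
  Multiplicative.toAdd (foxHom s w).left

theorem foxHom_right {I : Type} (s : I) (w : FreeGroup I) : (foxHom s w).right = w := by
  have : (SemidirectProduct.rightHom.comp (foxHom s)) = MonoidHom.id (FreeGroup I) := by
    ext t; simp [foxHom]
  exact DFunLike.congr_fun this w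

open Classical in
theorem foxDeriv_of {I : Type} (s t : I) :
    foxDeriv s (FreeGroup.of t) = if t = s then 1 else 0 := by
  simp [foxDeriv, foxHom]

theorem foxDeriv_mul {I : Type} (s : I) (u w : FreeGroup I) :
    foxDeriv s (u * w) = foxDeriv s u + MonoidAlgebra.of ℤ _ u * foxDeriv s w := by
  simp only [foxDeriv, map_mul, SemidirectProduct.mul_left, foxHom_right]
  rfl


/-! ### Standard presentations -/

/-- Names of the standard generators `x_1, …, x_g`, `y_1, …, y_g`, `z_1, …, z_b`. -/
abbrev Gen (g b : ℕ) : Type := Fin g ⊕ Fin g ⊕ Fin b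

/-- The name of the generator `x_i`. -/
abbrev Gen.x {g b : ℕ} (i : Fin g) : Gen g b := Sum.inl i

/-- The name of the generator `y_i`. -/
abbrev Gen.y {g b : ℕ} (i : Fin g) : Gen g b := Sum.inr (Sum.inl i)

/-- The name of the generator `z_j`. -/
abbrev Gen.z {g b : ℕ} (j : Fin b) : Gen g b := Sum.inr (Sum.inr j)

/-- The relator `R = [x_1, y_1] ⋯ [x_g, y_g] z_1 ⋯ z_b`. -/
def surfaceRelator (g b : ℕ) : FreeGroup (Gen g b) :=
  (List.ofFn fun i : Fin g =>
      FreeGroup.of (Gen.x i : Gen g b) * FreeGroup.of (Gen.y i) *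
        (FreeGroup.of (Gen.x i))⁻¹ * (FreeGroup.of (Gen.y i))⁻¹).prod *
    (List.ofFn fun j : Fin b => FreeGroup.of (Gen.z j : Gen g b)).prod

/-- The elements `v` of `Γ` give a presentation `⟨x_1, y_1, …, x_g, y_g, z_1, …, z_b | R⟩`
of `Γ`. -/
def IsStandardPresentation {Γ : Type} [Group Γ] {g b : ℕ} (v : Gen g b → Γ) : Prop :=
  Function.Surjective (FreeGroup.lift v) ∧
    (FreeGroup.lift v).ker = Subgroup.normalClosure {surfaceRelator g b}

theorem IsStandardPresentation.lift_relator {Γ : Type} [Group Γ] {g b : ℕ} {v : Gen g b → Γ}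
    (h : IsStandardPresentation v) : FreeGroup.lift v (surfaceRelator g b) = 1 := by
  rw [← MonoidHom.mem_ker, h.2]
  exact Subgroup.subset_normalClosure rfl

/-! ### Parabolic cohomology and the pairing -/

/-- The restriction map `f^* : H¹(Γ; g_ρ) → H¹(Γ'; g_{ρ ∘ f})` of a homomorphism `f : Γ' → Γ`. -/
def resH1 {n : ℕ} {Γ Γ' : Type} [Group Γ] [Group Γ'] (ρ : Γ →* PSL(n, ℝ)) (f : Γ' →* Γ) :
    groupCohomology.H1 (adModule ρ) →ₗ[ℝ] groupCohomology.H1 (adModule (ρ.comp f)) :=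
  (groupCohomology.map f
    (CategoryTheory.CategoryStruct.id (adModule (ρ.comp f)) :
      Rep.res f (adModule ρ) ⟶ adModule (ρ.comp f)) 1).hom

/-- The parabolic cohomology `H¹_par(Γ, {⟨γ⟩ | γ ∈ T}; g_ρ)`: the classes in `H¹(Γ; g_ρ)` that
restrict to zero on every cyclic subgroup `⟨γ⟩` with `γ ∈ T`. -/
def H1par {n : ℕ} {Γ : Type} [Group Γ] (ρ : Γ →* PSL(n, ℝ)) (T : Set Γ) :
    Submodule ℝ (groupCohomology.H1 (adModule ρ)) :=
  ⨅ γ ∈ T, LinearMap.ker (resH1 ρ (Subgroup.zpowers γ).subtype)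

theorem H1par_anti {n : ℕ} {Γ : Type} [Group Γ] (ρ : Γ →* PSL(n, ℝ)) {T T' : Set Γ}
    (h : T ⊆ T') : H1par ρ T' ≤ H1par ρ T :=
  biInf_mono h

/-- A cocycle represents a parabolic class iff its restriction to each `⟨γ⟩`, `γ ∈ T`, is a
coboundary. -/
theorem mk_mem_H1par_iff {n : ℕ} {Γ : Type} [Group Γ] (ρ : Γ →* PSL(n, ℝ)) (T : Set Γ)
    (α : groupCohomology.cocycles₁ (adModule ρ)) :
    groupCohomology.H1π (adModule ρ) α ∈ H1par ρ T ↔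
      ∀ γ ∈ T, ∃ X : LieAlgebra.SpecialLinear.sl (Fin n) ℝ,
        ∀ δ ∈ Subgroup.zpowers γ, α δ = adRep n (ρ δ) X - X := by
  simp only [H1par, Submodule.mem_iInf, LinearMap.mem_ker]
  refine forall₂_congr fun γ _ => ?_
  let φ : Rep.res (Subgroup.zpowers γ).subtype (adModule ρ) ⟶
    adModule (ρ.comp (Subgroup.zpowers γ).subtype) := CategoryTheory.CategoryStruct.id _
  have h : resH1 ρ (Subgroup.zpowers γ).subtype (groupCohomology.H1π (adModule ρ) α) =
      groupCohomology.H1π (adModule (ρ.comp (Subgroup.zpowers γ).subtype))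
        (groupCohomology.mapCocycles₁ (Subgroup.zpowers γ).subtype φ α) :=
    groupCohomology.H1π_comp_map_apply (Subgroup.zpowers γ).subtype φ α
  have key : ∀ δ : Subgroup.zpowers γ,
      (groupCohomology.mapCocycles₁ (Subgroup.zpowers γ).subtype φ α) δ = α δ.1 := fun δ => rfl
  rw [h, groupCohomology.H1π_eq_zero_iff]
  generalize groupCohomology.mapCocycles₁ (Subgroup.zpowers γ).subtype φ α = α' at key
  constructor
  · rintro ⟨X, hX⟩
    refine ⟨X, fun δ hδ => ?_⟩
    rw [← key ⟨δ, hδ⟩, ← hX]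
    rfl
  · rintro ⟨X, hX⟩
    refine ⟨X, funext fun δ => ?_⟩
    rw [key, hX δ.1 δ.2]
    rfl

/-- The value `α(r̄)` of the `ℤ`-linear extension of `α : Γ → V` at the image of
`r ∈ ℤF` in `ℤΓ` under `F → Γ`, followed by the involution `γ ↦ γ⁻¹`. -/
def barEval {I Γ V : Type} [Group Γ] [AddCommGroup V] (v : I → Γ) (α : Γ → V)
    (r : MonoidAlgebra ℤ (FreeGroup I)) : V :=
  r.coeff.sum fun w c => c • α (FreeGroup.lift v w)⁻¹

/-- The number `⟨α ⌣ β, [Σ]⟩ = - ∑_s Tr α(∂R/∂s bar) β(s)`, where `s` runs over the standard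
generators `x_i, y_i, z_j`. -/
def cupPairing {n g b : ℕ} {Γ : Type} [Group Γ] (v : Gen g b → Γ)
    (α β : Γ → LieAlgebra.SpecialLinear.sl (Fin n) ℝ) : ℝ :=
  - ∑ s : Gen g b, trForm n (barEval v α (foxDeriv s (surfaceRelator g b))) (β (v s))

theorem exists_rep {n g b : ℕ} {Γ : Type} [Group Γ] (v : Gen g b → Γ) (ρ : Γ →* PSL(n, ℝ))
    (a : H1par ρ (Set.range fun j => v (Gen.z j))) :
    ∃ p : groupCohomology.cocycles₁ (adModule ρ) ×
        (Fin b → LieAlgebra.SpecialLinear.sl (Fin n) ℝ),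
      groupCohomology.H1π (adModule ρ) p.1 = a.1 ∧
        ∀ j, ∀ δ ∈ Subgroup.zpowers (v (Gen.z j)), p.1 δ = adRep n (ρ δ) (p.2 j) - p.2 j := by
  obtain ⟨a, ha⟩ := a
  induction a using groupCohomology.H1_induction_on with
  | h α =>
    have := (mk_mem_H1par_iff ρ _ α).1 ha
    choose X hX using fun j => this (v (Gen.z j)) ⟨j, rfl⟩
    exact ⟨(α, X), rfl, hX⟩

/-- The pairing `ω_K([α], [β]) = ⟨α ⌣ β, [Σ]⟩ - ∑_j Tr X_j β(z_j)` on the parabolic cohomology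
of `(Γ, {⟨z_j⟩})`, where `X_j` satisfies `α = d X_j` on `⟨z_j⟩`. It is computed here with some
choice of `α`, `β` and `X_j`; the theorem `omegaK_eq` below shows that all choices
give the same value. -/
def omegaK {n g b : ℕ} {Γ : Type} [Group Γ] (v : Gen g b → Γ) (ρ : Γ →* PSL(n, ℝ))
    (a c : H1par ρ (Set.range fun j => v (Gen.z j))) : ℝ :=
  cupPairing v (exists_rep v ρ a).choose.1 (exists_rep v ρ c).choose.1 -
    ∑ j, trForm n ((exists_rep v ρ a).choose.2 j) ((exists_rep v ρ c).choose.1 (v (Gen.z j)))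


section WellDefined

variable {n : ℕ} {I Γ : Type} [Group Γ]

theorem barEval_add (v : I → Γ) (α : Γ → LieAlgebra.SpecialLinear.sl (Fin n) ℝ)
    (r r' : MonoidAlgebra ℤ (FreeGroup I)) :
    barEval v α (r + r') = barEval v α r + barEval v α r' := by
  simp only [barEval, MonoidAlgebra.coeff_add]
  exact Finsupp.sum_add_index' (by simp) (by intros; rw [add_smul])

theorem barEval_single (v : I → Γ) (α : Γ → LieAlgebra.SpecialLinear.sl (Fin n) ℝ)
    (w : FreeGroup I) (c : ℤ) :
    barEval v α (MonoidAlgebra.single w c) = c • α (FreeGroup.lift v w)⁻¹ := by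
  simp only [barEval, MonoidAlgebra.coeff_single]
  exact Finsupp.sum_single_index (by simp)

/-- The linear extension to `ℤF` of the action of `F` on the module through `v` and `ρ`. -/
def actEval (v : I → Γ) (ρ : Γ →* PSL(n, ℝ)) (r : MonoidAlgebra ℤ (FreeGroup I))
    (Y : LieAlgebra.SpecialLinear.sl (Fin n) ℝ) : LieAlgebra.SpecialLinear.sl (Fin n) ℝ :=
  r.coeff.sum fun w c => c • adRep n (ρ (FreeGroup.lift v w)) Y

theorem actEval_add (v : I → Γ) (ρ : Γ →* PSL(n, ℝ)) (r r' : MonoidAlgebra ℤ (FreeGroup I))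
    (Y : LieAlgebra.SpecialLinear.sl (Fin n) ℝ) :
    actEval v ρ (r + r') Y = actEval v ρ r Y + actEval v ρ r' Y := by
  simp only [actEval, MonoidAlgebra.coeff_add]
  exact Finsupp.sum_add_index' (by simp) (by intros; rw [add_smul])

theorem actEval_single (v : I → Γ) (ρ : Γ →* PSL(n, ℝ)) (w : FreeGroup I) (c : ℤ)
    (Y : LieAlgebra.SpecialLinear.sl (Fin n) ℝ) :
    actEval v ρ (MonoidAlgebra.single w c) Y = c • adRep n (ρ (FreeGroup.lift v w)) Y := by
  simp only [actEval, MonoidAlgebra.coeff_single]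
  exact Finsupp.sum_single_index (by simp)

theorem trForm_inv (g : PSL(n, ℝ)) (X Y : LieAlgebra.SpecialLinear.sl (Fin n) ℝ) :
    trForm n (adRep n g⁻¹ X) Y = trForm n X (adRep n g Y) := by
  rw [← trForm_adRep n g (adRep n g⁻¹ X) Y]
  congr 1
  rw [← Module.End.mul_apply, ← map_mul, mul_inv_cancel, map_one, Module.End.one_apply]

variable (v : I → Γ) (ρ : Γ →* PSL(n, ℝ)) {α β : Γ → LieAlgebra.SpecialLinear.sl (Fin n) ℝ}

theorem barEval_of_mul (hα : ∀ g h, α (g * h) = adRep n (ρ g) (α h) + α g) (u : FreeGroup I)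
    (r : MonoidAlgebra ℤ (FreeGroup I)) (Y : LieAlgebra.SpecialLinear.sl (Fin n) ℝ) :
    trForm n (barEval v α (MonoidAlgebra.of ℤ _ u * r)) Y = trForm n (barEval v α r) Y +
      trForm n (α (FreeGroup.lift v u)⁻¹) (actEval v ρ r Y) := by
  induction r using MonoidAlgebra.induction_linear with
  | zero => simp [barEval, actEval]
  | add r r' h h' =>
    rw [mul_add, barEval_add, barEval_add, actEval_add, map_add, map_add, map_add,
      LinearMap.add_apply, LinearMap.add_apply, h, h']
    abel
  | single w c =>
    rw [MonoidAlgebra.of_apply, MonoidAlgebra.single_mul_single, one_mul, barEval_single,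
      barEval_single, actEval_single, map_mul, mul_inv_rev, hα, smul_add, map_add,
      LinearMap.add_apply, add_comm, map_zsmul, map_zsmul, map_zsmul, LinearMap.smul_apply, LinearMap.smul_apply,
      map_inv, trForm_inv]

theorem actEval_of_mul (u : FreeGroup I) (r : MonoidAlgebra ℤ (FreeGroup I))
    (Y : LieAlgebra.SpecialLinear.sl (Fin n) ℝ) :
    actEval v ρ (MonoidAlgebra.of ℤ _ u * r) Y =
      adRep n (ρ (FreeGroup.lift v u)) (actEval v ρ r Y) := by
  induction r using MonoidAlgebra.induction_linear with
  | zero => simp [actEval]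
  | add r r' h h' => rw [mul_add, actEval_add, actEval_add, h, h', map_add]
  | single w c =>
    rw [MonoidAlgebra.of_apply, MonoidAlgebra.single_mul_single, one_mul, actEval_single,
      actEval_single, map_mul, map_mul, map_mul, Module.End.mul_apply, map_zsmul]

theorem freeGroup_ext_real {f : FreeGroup I → ℝ} (hf : ∀ u w, f (u * w) = f u + f w)
    (hs : ∀ s, f (FreeGroup.of s) = 0) (w : FreeGroup I) : f w = 0 := by
  have h1 : f 1 = 0 := by simpa using hf 1 1
  induction w using FreeGroup.induction_on with
  | C1 => exact h1
  | of s => exact hs s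
  | inv_of s h =>
    have := hf (FreeGroup.of s)⁻¹ (FreeGroup.of s)
    rw [inv_mul_cancel, h1, hs] at this
    linarith
  | mul u w hu hw => rw [hf, hu, hw, add_zero]

theorem foxDeriv_one (s : I) : foxDeriv s (1 : FreeGroup I) = 0 := by
  have h := foxDeriv_mul s (1 : FreeGroup I) 1
  rw [map_one, one_mul, one_mul] at h
  exact left_eq_add.1 h

theorem sum_actEval [Fintype I] (hβ : ∀ g h, β (g * h) = adRep n (ρ g) (β h) + β g)
    (w : FreeGroup I) :
    ∑ s, actEval v ρ (foxDeriv s w) (β (v s)) = β (FreeGroup.lift v w) := by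
  classical
  have hβ1 : β 1 = 0 := by simpa using hβ 1 1
  have h0 : ∀ Y, actEval v ρ 0 Y = 0 := fun Y => by simp [actEval]
  have hmul : ∀ u w : FreeGroup I,
      ∑ s, actEval v ρ (foxDeriv s (u * w)) (β (v s)) =
        ∑ s, actEval v ρ (foxDeriv s u) (β (v s)) +
          adRep n (ρ (FreeGroup.lift v u)) (∑ s, actEval v ρ (foxDeriv s w) (β (v s))) := by
    intro u w
    simp only [foxDeriv_mul, actEval_add, actEval_of_mul, Finset.sum_add_distrib, map_sum]
  have hof : ∀ t : I, ∑ s, actEval v ρ (foxDeriv s (FreeGroup.of t)) (β (v s)) = β (v t) := by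
    intro t
    rw [Finset.sum_eq_single t]
    · rw [foxDeriv_of, if_pos rfl, MonoidAlgebra.one_def, actEval_single]
      simp
    · intro s _ hs
      rw [foxDeriv_of, if_neg hs.symm, h0]
    · simp
  induction w using FreeGroup.induction_on with
  | C1 => simp [foxDeriv_one, h0, hβ1]
  | of t => rw [hof, FreeGroup.lift_apply_of]
  | inv_of t _ =>
    have h1 := hmul (FreeGroup.of t)⁻¹ (FreeGroup.of t)
    have h2 := hβ (v t)⁻¹ (v t)
    rw [inv_mul_cancel, hβ1] at h2
    simp only [inv_mul_cancel, foxDeriv_one, h0, Finset.sum_const_zero, map_inv,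
      FreeGroup.lift_apply_of, hof] at h1
    rw [map_inv, FreeGroup.lift_apply_of]
    rw [map_inv] at h2
    rw [← add_left_cancel_iff (a := adRep n (ρ (v t))⁻¹ (β (v t))), ← h2, add_comm, ← h1]
  | mul u w hu hw => rw [hmul, hu, hw, map_mul, hβ, add_comm]

theorem sum_fox_mul [Fintype I] (hα : ∀ g h, α (g * h) = adRep n (ρ g) (α h) + α g)
    (hβ : ∀ g h, β (g * h) = adRep n (ρ g) (β h) + β g) (u w : FreeGroup I) :
    ∑ s, trForm n (barEval v α (foxDeriv s (u * w))) (β (v s)) =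
      ∑ s, trForm n (barEval v α (foxDeriv s u)) (β (v s)) +
      ∑ s, trForm n (barEval v α (foxDeriv s w)) (β (v s)) +
        trForm n (α (FreeGroup.lift v u)⁻¹) (β (FreeGroup.lift v w)) := by
  simp only [foxDeriv_mul, barEval_add, map_add, LinearMap.add_apply, barEval_of_mul v ρ hα,
    Finset.sum_add_distrib, ← sum_actEval v ρ hβ w, map_sum]
  abel

theorem sum_fox_of [Fintype I] (hα : ∀ g h, α (g * h) = adRep n (ρ g) (α h) + α g) (t : I) :
    ∑ s, trForm n (barEval v α (foxDeriv s (FreeGroup.of t))) (β (v s)) = 0 := by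
  classical
  have hα1 : α 1 = 0 := by simpa using hα 1 1
  refine Finset.sum_eq_zero fun s _ => ?_
  rw [foxDeriv_of]
  split_ifs
  · rw [MonoidAlgebra.one_def, barEval_single]
    simp [hα1]
  · simp [barEval]

end WellDefined

section WellDefined

variable {n g b : ℕ} {Γ : Type} [Group Γ]

/-- An additive function on the free group takes the value `∑ f(z_j)` on the relator. -/
theorem additive_relator {f : FreeGroup (Gen g b) → ℝ} (hf : ∀ u w, f (u * w) = f u + f w) :
    f (surfaceRelator g b) = ∑ j, f (FreeGroup.of (Gen.z j)) := by
  have h1 : f 1 = 0 := by simpa using hf 1 1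
  have hinv : ∀ u, f u⁻¹ = - f u := fun u => by
    have := hf u⁻¹ u
    rw [inv_mul_cancel, h1] at this
    linarith
  have hprod : ∀ L : List (FreeGroup (Gen g b)), f L.prod = (L.map f).sum := by
    intro L
    induction L with
    | nil => simpa using h1
    | cons a L ih => simp [hf, ih]
  rw [surfaceRelator, hf, hprod, hprod, List.map_ofFn, List.map_ofFn, List.sum_ofFn, List.sum_ofFn]
  have : ∑ i : Fin g, (f ∘ fun i : Fin g =>
      FreeGroup.of (Gen.x i : Gen g b) * FreeGroup.of (Gen.y i) *
        (FreeGroup.of (Gen.x i))⁻¹ * (FreeGroup.of (Gen.y i))⁻¹) i = 0 := by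
    refine Finset.sum_eq_zero fun i _ => ?_
    simp only [Function.comp, hf, hinv]
    ring
  rw [this, zero_add]
  rfl

variable (v : Gen g b → Γ) (ρ : Γ →* PSL(n, ℝ)) {α β : Γ → LieAlgebra.SpecialLinear.sl (Fin n) ℝ}

/-- `⟨dX ⌣ β, [Σ]⟩ = ∑ Tr X β(z_j)`. -/
theorem cupPairing_coboundary_left (hv : FreeGroup.lift v (surfaceRelator g b) = 1)
    (hβ : ∀ g h, β (g * h) = adRep n (ρ g) (β h) + β g)
    (X : LieAlgebra.SpecialLinear.sl (Fin n) ℝ) :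
    cupPairing v (fun γ => adRep n (ρ γ) X - X) β = ∑ j, trForm n X (β (v (Gen.z j))) := by
  have hβ1 : β 1 = 0 := by simpa using hβ 1 1
  have hα : ∀ g h : Γ, (fun γ => adRep n (ρ γ) X - X) (g * h) =
      adRep n (ρ g) ((fun γ => adRep n (ρ γ) X - X) h) + (fun γ => adRep n (ρ γ) X - X) g := by
    intro g h
    simp only [map_mul, Module.End.mul_apply, map_sub]
    abel
  set f : FreeGroup (Gen g b) → ℝ := fun w => trForm n X (β (FreeGroup.lift v w)) -
    ∑ s, trForm n (barEval v (fun γ => adRep n (ρ γ) X - X) (foxDeriv s w)) (β (v s)) with hfdef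
  have hf : ∀ u w, f (u * w) = f u + f w := by
    intro u w
    simp only [hfdef]
    rw [sum_fox_mul v ρ (α := fun γ => adRep n (ρ γ) X - X) hα hβ, map_mul, hβ, map_add, map_sub, LinearMap.sub_apply, map_inv,
      trForm_inv]
    ring
  have h := additive_relator hf
  have h0 := fun t => sum_fox_of v ρ (α := fun γ => adRep n (ρ γ) X - X) (β := β) hα t
  simp only [hfdef, hv, hβ1, h0, FreeGroup.lift_apply_of, map_zero, zero_sub, sub_zero] at h
  exact h

/-- `⟨α ⌣ dY, [Σ]⟩ = ∑ Tr α(z_j⁻¹) Y`. -/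
theorem cupPairing_coboundary_right (hv : FreeGroup.lift v (surfaceRelator g b) = 1)
    (hα : ∀ g h, α (g * h) = adRep n (ρ g) (α h) + α g)
    (Y : LieAlgebra.SpecialLinear.sl (Fin n) ℝ) :
    cupPairing v α (fun γ => adRep n (ρ γ) Y - Y) =
      ∑ j, trForm n (α (v (Gen.z j))⁻¹) Y := by
  have hα1 : α 1 = 0 := by simpa using hα 1 1
  have hβ : ∀ g h : Γ, (fun γ => adRep n (ρ γ) Y - Y) (g * h) =
      adRep n (ρ g) ((fun γ => adRep n (ρ γ) Y - Y) h) + (fun γ => adRep n (ρ γ) Y - Y) g := by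
    intro g h
    simp only [map_mul, Module.End.mul_apply, map_sub]
    abel
  set f : FreeGroup (Gen g b) → ℝ := fun w => trForm n (α (FreeGroup.lift v w)⁻¹) Y -
    ∑ s, trForm n (barEval v α (foxDeriv s w)) (adRep n (ρ (v s)) Y - Y) with hfdef
  have hf : ∀ u w, f (u * w) = f u + f w := by
    intro u w
    have := sum_fox_mul v ρ (β := fun γ => adRep n (ρ γ) Y - Y) hα hβ u w
    simp only [hfdef]
    rw [this, map_mul, mul_inv_rev, hα, map_add, LinearMap.add_apply, map_sub, map_inv,
      trForm_inv]
    ring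
  have h := additive_relator hf
  have h0 := fun t => sum_fox_of v ρ (β := fun γ => adRep n (ρ γ) Y - Y) hα t
  simp only [hfdef, hv, inv_one, hα1, h0, FreeGroup.lift_apply_of, map_zero,
    LinearMap.zero_apply, zero_sub, sub_zero] at h
  exact h

theorem cupPairing_sub_left {α' : Γ → LieAlgebra.SpecialLinear.sl (Fin n) ℝ} :
    cupPairing v (α - α') β = cupPairing v α β - cupPairing v α' β := by
  have h : ∀ r, barEval v (α - α') r = barEval v α r - barEval v α' r := fun r => by
    simp [barEval, Finsupp.sum, smul_sub]
  simp only [cupPairing, h, map_sub, LinearMap.sub_apply, Finset.sum_sub_distrib]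
  ring

theorem cupPairing_sub_right {β' : Γ → LieAlgebra.SpecialLinear.sl (Fin n) ℝ} :
    cupPairing v α (β - β') = cupPairing v α β - cupPairing v α β' := by
  simp only [cupPairing, Pi.sub_apply, map_sub, Finset.sum_sub_distrib]
  ring

/-- The pairing can be computed with arbitrary cocycles `α`, `β` in the two classes and arbitrary
`X_j` with `α = d X_j` on `⟨z_j⟩`. -/
theorem omegaK_eq (hv : FreeGroup.lift v (surfaceRelator g b) = 1)
    (a c : H1par ρ (Set.range fun j => v (Gen.z j)))
    (α β : groupCohomology.cocycles₁ (adModule ρ))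
    (hα : groupCohomology.H1π (adModule ρ) α = a.1)
    (hβ : groupCohomology.H1π (adModule ρ) β = c.1)
    (X : Fin b → LieAlgebra.SpecialLinear.sl (Fin n) ℝ)
    (hX : ∀ j, α (v (Gen.z j)) = adRep n (ρ (v (Gen.z j))) (X j) - X j) :
    omegaK v ρ a c = cupPairing v α β - ∑ j, trForm n (X j) (β (v (Gen.z j))) := by
  have hcoc : ∀ (φ : groupCohomology.cocycles₁ (adModule ρ)) (g h : Γ),
      φ (g * h) = adRep n (ρ g) (φ h) + φ g := fun φ =>
    (groupCohomology.mem_cocycles₁_iff _).1 φ.2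
  have hinv : ∀ (φ : groupCohomology.cocycles₁ (adModule ρ)) (γ : Γ)
      (Z : LieAlgebra.SpecialLinear.sl (Fin n) ℝ), φ γ = adRep n (ρ γ) Z - Z →
      φ γ⁻¹ = adRep n (ρ γ⁻¹) Z - Z := by
    intro φ γ Z h
    have h1 := hcoc φ γ⁻¹ γ
    have h2 : φ 1 = 0 := groupCohomology.cocycles₁_map_one φ
    rw [inv_mul_cancel, h2, h, map_sub, ← Module.End.mul_apply, ← map_mul, ← map_mul,
      inv_mul_cancel, map_one, map_one, Module.End.one_apply] at h1
    rw [eq_neg_of_add_eq_zero_right h1.symm]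
    abel
  unfold omegaK
  obtain ⟨hα', hX'⟩ := (exists_rep v ρ a).choose_spec
  obtain ⟨hβ', hZ⟩ := (exists_rep v ρ c).choose_spec
  generalize (exists_rep v ρ a).choose = p at *
  generalize (exists_rep v ρ c).choose = q at *
  obtain ⟨α', X'⟩ := p
  obtain ⟨β', Z⟩ := q
  simp only at *
  replace hX' := fun j => hX' j _ (Subgroup.mem_zpowers _)
  replace hZ := fun j => hZ j _ (Subgroup.mem_zpowers _)
  obtain ⟨A, hA⟩ := (groupCohomology.H1π_eq_iff α α').1 (hα.trans hα'.symm)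
  obtain ⟨Y, hY⟩ := (groupCohomology.H1π_eq_iff β β').1 (hβ.trans hβ'.symm)
  replace hA : ⇑α - ⇑α' = fun γ => adRep n (ρ γ) A - A := hA.symm
  replace hY : ⇑β - ⇑β' = fun γ => adRep n (ρ γ) Y - Y := hY.symm
  have e1 := cupPairing_sub_left v (α := α) (α' := α') (β := β')
  have e2 := cupPairing_sub_right v (α := α) (β := β) (β' := β')
  rw [hA, cupPairing_coboundary_left v ρ hv (hcoc β')] at e1
  rw [hY, cupPairing_coboundary_right v ρ hv (hcoc α)] at e2
  have e3 : ∑ j, trForm n (X j) (β (v (Gen.z j))) - ∑ j, trForm n (X j) (β' (v (Gen.z j))) =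
      ∑ j, trForm n (α (v (Gen.z j))⁻¹) Y := by
    rw [← Finset.sum_sub_distrib]
    refine Finset.sum_congr rfl fun j _ => ?_
    rw [hinv α _ _ (hX j), ← map_sub]
    have : β (v (Gen.z j)) - β' (v (Gen.z j)) = adRep n (ρ (v (Gen.z j))) Y - Y := congrFun hY _
    rw [this, map_sub, map_sub, LinearMap.sub_apply, map_inv, trForm_inv]
  have e4 : ∑ j, trForm n (X j) (β' (v (Gen.z j))) - ∑ j, trForm n (X' j) (β' (v (Gen.z j))) =
      ∑ j, trForm n A (β' (v (Gen.z j))) := by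
    rw [← Finset.sum_sub_distrib]
    refine Finset.sum_congr rfl fun j _ => ?_
    have h : α (v (Gen.z j)) - α' (v (Gen.z j)) = adRep n (ρ (v (Gen.z j))) A - A := congrFun hA _
    rw [hX, hX'] at h
    have hD : adRep n (ρ (v (Gen.z j))) (X j - X' j - A) = X j - X' j - A := by
      rw [map_sub, map_sub, ← sub_eq_zero, ← sub_eq_zero.2 h]
      abel
    have hD' : adRep n (ρ (v (Gen.z j)))⁻¹ (X j - X' j - A) = X j - X' j - A := by
      conv_lhs => rw [← hD]
      rw [← Module.End.mul_apply, ← map_mul, inv_mul_cancel, map_one, Module.End.one_apply]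
    have h0 : trForm n (X j - X' j - A) (β' (v (Gen.z j))) = 0 := by
      rw [hZ, map_sub, ← trForm_inv, hD', sub_self]
    rw [map_sub, map_sub, LinearMap.sub_apply, LinearMap.sub_apply] at h0
    linarith
  linarith

end WellDefined

/-- `ρ : Γ → PSL_n(ℝ)` is irreducible: no proper nonzero subspace of `ℝⁿ` is preserved by
all (lifts to `SL_n(ℝ)` of) elements `ρ(γ)`. -/
def IsIrreducibleRep {n : ℕ} {Γ : Type} [Group Γ] (ρ : Γ →* PSL(n, ℝ)) : Prop :=
  ∀ W : Submodule ℝ (Fin n → ℝ),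
    (∀ γ : Γ, ∀ A : SL(n, ℝ), (QuotientGroup.mk A : PSL(n, ℝ)) = ρ γ →
      ∀ w ∈ W, (A : Matrix (Fin n) (Fin n) ℝ).mulVec w ∈ W) →
    W = ⊥ ∨ W = ⊤

/-- The good representations: irreducible, with trivial centralizer in `PSL_n(ℝ)`. -/
structure IsGoodRep {n : ℕ} {Γ : Type} [Group Γ] (ρ : Γ →* PSL(n, ℝ)) : Prop where
  irreducible : IsIrreducibleRep ρ
  centralizer_trivial : ∀ a : PSL(n, ℝ), (∀ γ, a * ρ γ * a⁻¹ = ρ γ) → a = 1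

/-! ### Oriented surfaces and curves

A surface with boundary is a manifold modelled on the half plane `{x₀ ≥ 0}`. Closed curves are
maps `ℝ → S` of period `1`. -/

/-- All coordinate changes of the atlas have positive Jacobian determinant; the surface then
carries the orientation for which the charts of the atlas are positively oriented. -/
class OrientedAtlas (S : Type) [TopologicalSpace S] [ChartedSpace (EuclideanHalfSpace 2) S] :
    Prop where
  det_pos : ∀ e ∈ atlas (EuclideanHalfSpace 2) S, ∀ e' ∈ atlas (EuclideanHalfSpace 2) S,
    ∀ x ∈ e.source ∩ e'.source,
      0 < LinearMap.det (fderivWithin ℝ (e'.extend (𝓡∂ 2) ∘ (e.extend (𝓡∂ 2)).symm)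
        (Set.range (𝓡∂ 2)) (e.extend (𝓡∂ 2) x) :
          EuclideanSpace ℝ (Fin 2) →ₗ[ℝ] EuclideanSpace ℝ (Fin 2))

section Topology

variable {S : Type} [TopologicalSpace S]

/-- The fundamental group of a subspace `V ⊆ S`, where `γ δ` is the loop `γ` followed by the
loop `δ`. (Mathlib's `FundamentalGroup` has the opposite order of multiplication.) -/
abbrev Pi1 (V : Set S) (p : V) : Type := (FundamentalGroup V p)ᵐᵒᵖ

/-- The class of a loop. -/
def Pi1.mk {V : Set S} {p : V} (u : Path p p) : Pi1 V p :=
  MulOpposite.op (FundamentalGroup.fromPath (Path.Homotopic.Quotient.mk u))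

/-- The homomorphism induced by an inclusion `V ⊆ W`. -/
def Pi1.incl {V W : Set S} (h : V ⊆ W) (p : V) : Pi1 V p →* Pi1 W (Set.inclusion h p) :=
  MonoidHom.op (FundamentalGroup.map ⟨Set.inclusion h, continuous_inclusion h⟩ p)

/-- The homomorphism `γ ↦ η⁻¹ γ η` induced by an inclusion `V ⊆ W` and a path `η` in `W` from the
base point `p` of `V` to the base point `q` of `W`. -/
def Pi1.inclPath {V W : Set S} (h : V ⊆ W) {p : V} {q : W} (η : Path (Set.inclusion h p) q) :
    Pi1 V p →* Pi1 W q :=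
  (MonoidHom.op (FundamentalGroup.fundamentalGroupMulEquivOfPath η).toMonoidHom).comp
    (Pi1.incl h p)

variable [ChartedSpace (EuclideanHalfSpace 2) S]

/-- The velocity of a curve in the surface, in the coordinates of the preferred chart. -/
def velocity (c : ℝ → S) (s : ℝ) : EuclideanSpace ℝ (Fin 2) :=
  mfderiv 𝓘(ℝ, ℝ) (𝓡∂ 2) c s (1 : ℝ)

/-- `v, w` is a positively oriented basis of the plane. -/
def IsPositiveBasis (v w : EuclideanSpace ℝ (Fin 2)) : Prop :=
  0 < v 0 * w 1 - v 1 * w 0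

/-- A smoothly embedded closed curve. -/
structure IsSimpleClosedCurve (c : ℝ → S) : Prop where
  smooth : ContMDiff 𝓘(ℝ, ℝ) (𝓡∂ 2) ∞ c
  periodic : ∀ s, c (s + 1) = c s
  injOn : Set.InjOn c (Set.Ico 0 1)
  regular : ∀ s, velocity c s ≠ 0

/-- `ζ` parametrizes the boundary components of the surface, each with the boundary orientation:
the surface lies to the left of its boundary. (In a chart the surface is `{x₀ ≥ 0}`, and
it lies to the left when the boundary is traversed with `x₁` decreasing.) -/
structure IsBoundary {b : ℕ} (ζ : Fin b → ℝ → S) : Prop where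
  simple : ∀ j, IsSimpleClosedCurve (ζ j)
  disjoint : Pairwise fun i j => Disjoint (Set.range (ζ i)) (Set.range (ζ j))
  cover : ⋃ j, Set.range (ζ j) = (𝓡∂ 2).boundary S
  positive : ∀ j s, velocity (ζ j) s 1 < 0

/-- `F` is a smooth orientation preserving embedding of the annulus `(ℝ/ℤ) × (-1, 1)` with
core curve `c`. -/
structure IsAnnulus (F : ℝ × ℝ → S) (c : ℝ → S) : Prop where
  smooth : ContMDiffOn 𝓘(ℝ, ℝ × ℝ) (𝓡∂ 2) ∞ F (Set.univ ×ˢ Set.Ioo (-1) 1)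
  periodic : ∀ s t, F (s + 1, t) = F (s, t)
  core : ∀ s, F (s, 0) = c s
  injOn : Set.InjOn F (Set.Ico 0 1 ×ˢ Set.Ioo (-1) 1)
  positive : ∀ x ∈ (Set.univ ×ˢ Set.Ioo (-1) 1 : Set (ℝ × ℝ)),
    IsPositiveBasis (mfderiv 𝓘(ℝ, ℝ × ℝ) (𝓡∂ 2) F x ((1, 0) : ℝ × ℝ))
      (mfderiv 𝓘(ℝ, ℝ × ℝ) (𝓡∂ 2) F x ((0, 1) : ℝ × ℝ))

/-- Pairwise disjoint, smoothly embedded closed curves in the interior of the surface, i.e. cores of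
embedded annuli (the orientation of the surface makes every embedded closed curve two-sided). -/
structure IsCurveSystem {m : ℕ} (ξ : Fin m → ℝ → S) : Prop where
  simple : ∀ k, IsSimpleClosedCurve (ξ k)
  annulus : ∀ k, ∃ F : ℝ × ℝ → S, IsAnnulus F (ξ k)
  disjoint : Pairwise fun i k => Disjoint (Set.range (ξ i)) (Set.range (ξ k))
  interior : ∀ k s, ξ k s ∈ (𝓡∂ 2).interior S

/-- `U 1, …, U l` are the subsurfaces into which the curves `ξ` divide `S`: the connected
components of the complement, each listed once. -/
structure IsCutting {m l : ℕ} (ξ : Fin m → ℝ → S) (U : Fin l → Set S) : Prop where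
  injective : Function.Injective U
  range_eq : Set.range U =
    {W | ∃ x ∈ (⋃ k, Set.range (ξ k))ᶜ, W = connectedComponentIn (⋃ k, Set.range (ξ k))ᶜ x}

/-- The curve `c` with the opposite orientation. -/
def reverseCurve (c : ℝ → S) : ℝ → S := fun s => c (-s)

/-- `γ ∈ π₁(V, p)` is freely homotopic to the closed curve `c` pushed into `V` towards the
left side of `c`: a free homotopy starts at `c`, leaves `c` to the left, stays
in `V` afterwards and ends at a loop at `p` that represents `γ`. If `V` lies (near `c`) to the
left of `c`, then `c` is a component of the boundary of the completion of `V`, with the boundary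
orientation, and the elements `γ` are those that represent this component. -/
def IsPushOff (V : Set S) (p : V) (c : ℝ → S) (γ : Pi1 V p) : Prop :=
  ∃ H : ℝ → ℝ → S,
    ContinuousOn (Function.uncurry H) (Set.univ ×ˢ Set.Icc 0 1) ∧
    (∀ s, ∀ t ∈ Set.Icc (0 : ℝ) 1, H (s + 1) t = H s t) ∧
    (∀ s, H s 0 = c s) ∧
    (∀ s, ∀ t ∈ Set.Ioc (0 : ℝ) 1, H s t ∈ V) ∧
    (∀ s, IsPositiveBasis (velocity c s)
      (mfderivWithin 𝓘(ℝ, ℝ) (𝓡∂ 2) (H s) (Set.Icc 0 1) 0 (1 : ℝ))) ∧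
    ∃ u : Path p p, (∀ s : unitInterval, (u s : S) = H s 1) ∧ γ = Pi1.mk u

/-- The circle of radius `r` around the interior point `q`, in the preferred chart at `q`,
traversed clockwise, so that the complement of the disc lies to its left. -/
def smallCircle (q : S) (r : ℝ) : ℝ → S := fun s =>
  (extChartAt (𝓡∂ 2) q).symm (extChartAt (𝓡∂ 2) q q +
    r • !₂[Real.cos (2 * Real.pi * s), -Real.sin (2 * Real.pi * s)])

/-- `γ ∈ π₁(V ∖ {q})` represents the new boundary component that arises when a
small disc around `q` is removed from `V`. -/
def IsPunctureLoop (V : Set S) (q : S) (p : ↥(V \ {q})) (γ : Pi1 (V \ {q}) p) : Prop :=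
  ∃ r > 0, Metric.closedBall (extChartAt (𝓡∂ 2) q q) r ⊆ (extChartAt (𝓡∂ 2) q).target ∧
    (extChartAt (𝓡∂ 2) q).symm '' Metric.closedBall (extChartAt (𝓡∂ 2) q q) r ⊆ V ∧
    IsPushOff (V \ {q}) p (smallCircle q r) γ

/-- Standard generators together with one more generator `z_{b+1} = w`. -/
def addBoundary {Γ : Type} {g b : ℕ} (v : Gen g b → Γ) (w : Γ) : Gen g (b + 1) → Γ :=
  Sum.elim (fun i => v (Gen.x i))
    (Sum.elim (fun i => v (Gen.y i)) (Fin.snoc (fun j => v (Gen.z j)) w))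

/-- A standard presentation `⟨x_1, y_1, …, x_g, y_g, z_1, …, z_b | R⟩` of the fundamental group of a
hyperbolic surface `V ⊆ S` of genus `g`. The family `c` consists of closed
curves in `S`; those with `V` on their left are the components of the boundary of the completion
of `V`, with the boundary orientation, and each is represented by exactly one `z_j`.

The presentation is positively oriented. This means that, as for the presentation read
off from a polygon centred at `q`, it lifts to the complement of every
interior point `q`: there the relator `R` is no longer trivial but is the loop around the
polygon, so that one gets a standard presentation of the punctured
surface with one more boundary component around `q`. For closed surfaces
this condition distinguishes the two orientations. -/
structure StandardSystem (V : Set S) (p : V) {K : Type} (c : K → ℝ → S) where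
  /-- The genus. -/
  g : ℕ
  /-- The number of boundary components. -/
  b : ℕ
  /-- The Euler characteristic `2 - 2g - b` is negative. -/
  hyperbolic : 2 < 2 * g + b
  /-- The generators. -/
  gen : Gen g b → Pi1 V p
  /-- The numbering of the boundary components. -/
  e : Fin b → K
  presents : IsStandardPresentation gen
  e_injective : Function.Injective e
  peripheral : ∀ j, IsPushOff V p (c (e j)) (gen (Gen.z j))
  complete : ∀ (k : K) (p' : V) (γ : Pi1 V p'), IsPushOff V p' (c k) γ → k ∈ Set.range e
  positive : ∀ q ∈ V, q ∈ (𝓡∂ 2).interior S → ∀ hq : (p : S) ≠ q,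
    ∃ (gen' : Gen g b → Pi1 (V \ {q}) ⟨p, p.2, hq⟩) (w : Pi1 (V \ {q}) ⟨p, p.2, hq⟩),
      (∀ s, Pi1.incl (W := V) Set.sdiff_subset ⟨p, p.2, hq⟩ (gen' s) = gen s) ∧
      (∀ j, IsPushOff (V \ {q}) ⟨p, p.2, hq⟩ (c (e j)) (gen' (Gen.z j))) ∧
      IsPunctureLoop V q ⟨p, p.2, hq⟩ w ∧
      IsStandardPresentation (addBoundary gen' w)

/-- The elements of `π₁(S)` that represent one of the closed curves `c k`, up to conjugation. -/
def curveClasses (p : (Set.univ : Set S)) {K : Type} (c : K → ℝ → S) : Set (Pi1 Set.univ p) :=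
  {γ | ∃ k, IsPushOff Set.univ p (c k) γ}

theorem StandardSystem.range_subset {p : (Set.univ : Set S)} {K K' : Type} {c : K → ℝ → S}
    (σ : StandardSystem Set.univ p c) (c' : K' → ℝ → S) :
    (Set.range fun j => σ.gen (Gen.z j)) ⊆ curveClasses p (Sum.elim c c') := by
  rintro _ ⟨j, rfl⟩
  exact ⟨Sum.inl (σ.e j), σ.peripheral j⟩

/-- The closed curves that bound the pieces after cutting along `ξ`: the
boundary curves and both orientations of every `ξ k`. -/
def cutCurves {b m : ℕ} (ζ : Fin b → ℝ → S) (ξ : Fin m → ℝ → S) :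
    Fin b ⊕ Fin m ⊕ Fin m → ℝ → S :=
  Sum.elim ζ (Sum.elim ξ fun k => reverseCurve (ξ k))

end Topology

end

/-! The pairing is a cup product evaluated on a fundamental class, corrected along the boundary. It
is computed from a primitive `f` of the 2-cocycle `(u, w) ↦ Tr α(u⁻¹) β(w)`: on words the Fox sum is
such a primitive, so it differs from `f` by an additive function, and an additive function sees only
the `z_j` in the relator `R`. Hence the uncorrected cup pairing is `∑ f(z_j) - f(R)`
(`IsCupPrimitive.cupPairing_eq`), and the pairing itself is a sum of boundary values `f(z_j) - Tr
X_j β(z_j)` minus `f(R)` (`omegaK_eq_sum`).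

For parabolic classes the boundary value of `γ` does not depend on the potential `X`, is invariant
under conjugation (`IsCupPrimitive.conj_eq`) and changes sign under `γ ↦ γ⁻¹`
(`IsCupPrimitive.inv_sub`). It is thus a number attached to an oriented closed curve. If one
primitive served the surface and all pieces, the theorem would follow by counting: each boundary
curve of the surface bounds one piece, and each cutting curve occurs twice, with opposite
orientations (`sum_boundary_pieces`).

On the group of a closed surface a primitive need not exist. The computation therefore takes place
in the group of the surface punctured at an interior point `x` off all curves and base points. There
the presentation has one more boundary generator `w`, and a primitive exists
(`IsStandardPresentation.exists_isCupPrimitive`). The cocycles are pulled back to this group, and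
the generators of the surface and of the pieces are lifted to it (`StandardSystem.exists_lift`). The
relator of the surface lifts to `w⁻¹`; that of a piece lifts to `1` if the piece misses `x`, and to
a conjugate of `w⁻¹` if it contains `x`. Exactly one piece contains `x`, so the correction `f(w⁻¹)`
occurs once on each side. The positivity condition on the presentations enters here: it fixes the
orientation of the loop around the puncture.

The topological part consists of two facts. Freely homotopic curves in the punctured surface give
conjugate elements (`Represents`). Each side of a cutting curve belongs to exactly one piece:
existence comes from half of an embedded annulus, uniqueness from the inverse function theorem
(`IsAnnulus.exists_mem_of_isPushOff`). -/

/-! ### Primitives of the cup product cocycle -/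

section Primitive

variable {n : ℕ} {Γ : Type} [Group Γ]

/-- `α` is a 1-cocycle with values in `sl_n(ℝ)` with the action `Ad ∘ ρ`. -/
def IsAdCocycle (ρ : Γ →* PSL(n, ℝ)) (α : Γ → LieAlgebra.SpecialLinear.sl (Fin n) ℝ) : Prop :=
  ∀ g h, α (g * h) = adRep n (ρ g) (α h) + α g

/-- `f` is a primitive of the 2-cocycle `(u, w) ↦ Tr α(u⁻¹) β(w)`. -/
def IsCupPrimitive (α β : Γ → LieAlgebra.SpecialLinear.sl (Fin n) ℝ) (f : Γ → ℝ) : Prop :=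
  ∀ u w, f (u * w) = f u + f w + trForm n (α u⁻¹) (β w)

/-- On `⟨γ⟩`, the cocycle `α` is the coboundary of `X`. -/
def IsLocalPotential (ρ : Γ →* PSL(n, ℝ)) (α : Γ → LieAlgebra.SpecialLinear.sl (Fin n) ℝ) (γ : Γ)
    (X : LieAlgebra.SpecialLinear.sl (Fin n) ℝ) : Prop :=
  α γ = adRep n (ρ γ) X - X

variable {ρ : Γ →* PSL(n, ℝ)} {α β : Γ → LieAlgebra.SpecialLinear.sl (Fin n) ℝ} {f : Γ → ℝ}
  {γ : Γ} {X Y : LieAlgebra.SpecialLinear.sl (Fin n) ℝ}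

theorem adRep_mul_apply (g h : PSL(n, ℝ)) (X : LieAlgebra.SpecialLinear.sl (Fin n) ℝ) :
    adRep n (g * h) X = adRep n g (adRep n h X) := by
  rw [map_mul, Module.End.mul_apply]

theorem adRep_one_apply (X : LieAlgebra.SpecialLinear.sl (Fin n) ℝ) : adRep n 1 X = X := by
  rw [map_one, Module.End.one_apply]

theorem adRep_inv_apply_self (g : PSL(n, ℝ)) (X : LieAlgebra.SpecialLinear.sl (Fin n) ℝ) :
    adRep n g⁻¹ (adRep n g X) = X := by
  rw [← adRep_mul_apply, inv_mul_cancel, adRep_one_apply]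

theorem adRep_self_apply_inv (g : PSL(n, ℝ)) (X : LieAlgebra.SpecialLinear.sl (Fin n) ℝ) :
    adRep n g (adRep n g⁻¹ X) = X := by
  rw [← adRep_mul_apply, mul_inv_cancel, adRep_one_apply]

theorem trForm_adRep_left (g : PSL(n, ℝ)) (X Y : LieAlgebra.SpecialLinear.sl (Fin n) ℝ) :
    trForm n (adRep n g X) Y = trForm n X (adRep n g⁻¹ Y) := by
  rw [← trForm_inv, inv_inv]

namespace IsAdCocycle

theorem map_one (hα : IsAdCocycle ρ α) : α 1 = 0 := by
  simpa using hα 1 1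

theorem map_inv (hα : IsAdCocycle ρ α) (g : Γ) : α g⁻¹ = -adRep n (ρ g)⁻¹ (α g) := by
  have h := hα g⁻¹ g
  rw [inv_mul_cancel, hα.map_one, _root_.map_inv] at h
  exact (neg_eq_of_add_eq_zero_right h.symm).symm

theorem comp (hα : IsAdCocycle ρ α) {Λ : Type} [Group Λ] (ι : Λ →* Γ) :
    IsAdCocycle (ρ.comp ι) (α ∘ ι) := fun g h => by
  simp only [Function.comp_apply, _root_.map_mul, hα (ι g) (ι h), MonoidHom.comp_apply]

end IsAdCocycle

namespace IsLocalPotential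

theorem inv (hα : IsAdCocycle ρ α) (hX : IsLocalPotential ρ α γ X) :
    IsLocalPotential ρ α γ⁻¹ X := by
  unfold IsLocalPotential at *
  rw [hα.map_inv, hX, map_sub, adRep_inv_apply_self, map_inv ρ, neg_sub]

/-- A potential on `⟨γ⟩` moves under conjugation by the affine action that the cocycle defines. -/
theorem conj (hα : IsAdCocycle ρ α) (hX : IsLocalPotential ρ α γ X) (g : Γ) :
    IsLocalPotential ρ α (g * γ * g⁻¹) (adRep n (ρ g) X - α g) := by
  unfold IsLocalPotential at *
  rw [hα, hα, hX, hα.map_inv]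
  simp only [map_mul ρ, map_sub, map_neg, map_inv ρ, adRep_mul_apply, adRep_inv_apply_self]
  abel

/-- Two potentials differ by a vector fixed by `γ`, and a fixed vector is orthogonal to every `γ · Y
- Y`. Thus the boundary term needs `β`, too, to be a coboundary on `⟨γ⟩`. -/
theorem trForm_eq (hX : IsLocalPotential ρ α γ X)
    {X' : LieAlgebra.SpecialLinear.sl (Fin n) ℝ} (hX' : IsLocalPotential ρ α γ X')
    (hY : IsLocalPotential ρ β γ Y) : trForm n X (β γ) = trForm n X' (β γ) := by
  unfold IsLocalPotential at *
  have hD : adRep n (ρ γ) (X - X') = X - X' := by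
    rw [map_sub, sub_eq_sub_iff_sub_eq_sub, ← hX, ← hX']
  have h0 : trForm n (X - X') (β γ) = 0 := by
    rw [hY, map_sub, ← trForm_inv]
    conv_lhs => enter [1, 1, 2, 2]; rw [← hD]
    rw [adRep_inv_apply_self, sub_self]
  rw [map_sub, LinearMap.sub_apply] at h0
  linarith

end IsLocalPotential

namespace IsCupPrimitive

theorem map_one (hα : IsAdCocycle ρ α) (hf : IsCupPrimitive α β f) : f 1 = 0 := by
  have h := hf 1 1
  rw [inv_one, hα.map_one, map_zero, LinearMap.zero_apply, mul_one] at h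
  linarith

/-- This sign is what makes the two sides of a cutting curve cancel. It comes from evaluating `f` on
`γ⁻¹ * γ = 1`. -/
theorem inv_sub (hα : IsAdCocycle ρ α) (hβ : IsAdCocycle ρ β) (hf : IsCupPrimitive α β f)
    (hX : IsLocalPotential ρ α γ X) :
    f γ⁻¹ - trForm n X (β γ⁻¹) = -(f γ - trForm n X (β γ)) := by
  have h := hf γ⁻¹ γ
  rw [inv_mul_cancel, hf.map_one hα, inv_inv, hX, map_sub, LinearMap.sub_apply] at h
  rw [hβ.map_inv, map_neg, ← trForm_adRep_left]
  linarith

/-- Neither `f` nor the trace term is a class function; their defects under conjugation cancel when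
the potential is moved along. -/
theorem conj_sub (hα : IsAdCocycle ρ α) (hβ : IsAdCocycle ρ β) (hf : IsCupPrimitive α β f)
    (hX : IsLocalPotential ρ α γ X) (g : Γ) :
    f (g * γ * g⁻¹) - trForm n (adRep n (ρ g) X - α g) (β (g * γ * g⁻¹)) =
      f γ - trForm n X (β γ) := by
  have h1 := hf g g⁻¹
  rw [mul_inv_cancel, hf.map_one hα] at h1
  have hX' := hX.inv hα
  unfold IsLocalPotential at hX'
  rw [hf, hf, mul_inv_rev, hα, hX', hβ, hβ]
  simp only [hα.map_inv, hβ.map_inv, _root_.map_mul ρ, map_sub, map_neg, map_add, _root_.map_inv ρ,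
    adRep_mul_apply, LinearMap.sub_apply, LinearMap.add_apply, LinearMap.neg_apply,
    trForm_adRep_left, inv_inv, adRep_inv_apply_self, adRep_self_apply_inv] at h1 ⊢
  linarith

/-- The value of `f` on the relator of a family `v` of elements, up to boundary terms. -/
theorem cupPairing_eq (hα : IsAdCocycle ρ α) (hβ : IsAdCocycle ρ β) (hf : IsCupPrimitive α β f)
    {g b : ℕ} (v : Gen g b → Γ) :
    cupPairing v α β =
      ∑ j, f (v (Gen.z j)) - f (FreeGroup.lift v (surfaceRelator g b)) := by
  -- Both terms are primitives of the same 2-cocycle on words, so their difference is additive.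
  set h : FreeGroup (Gen g b) → ℝ := fun w =>
    ∑ s, trForm n (barEval v α (foxDeriv s w)) (β (v s)) - f (FreeGroup.lift v w) with hh
  have hadd : ∀ u w, h (u * w) = h u + h w := fun u w => by
    simp only [hh]
    rw [sum_fox_mul v ρ hα hβ, _root_.map_mul, hf]
    ring
  have key := additive_relator hadd
  simp only [hh, sum_fox_of v ρ hα, FreeGroup.lift_apply_of, zero_sub,
    Finset.sum_neg_distrib] at key
  unfold cupPairing
  linarith

end IsCupPrimitive

/-- The pairing depends only on the values of the cocycles on words in the generators, so it may be
computed in any group to which the generators lift. -/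
theorem cupPairing_congr {g b : ℕ} {Λ : Type} [Group Λ] {v : Gen g b → Γ} {v' : Gen g b → Λ}
    {α' β' : Λ → LieAlgebra.SpecialLinear.sl (Fin n) ℝ}
    (hα : ∀ w, α (FreeGroup.lift v w) = α' (FreeGroup.lift v' w))
    (hβ : ∀ w, β (FreeGroup.lift v w) = β' (FreeGroup.lift v' w)) :
    cupPairing v α β = cupPairing v' α' β' := by
  have h1 : ∀ r, barEval v α r = barEval v' α' r := fun r => by
    simp only [barEval, ← map_inv, hα]
  have h2 : ∀ s, β (v s) = β' (v' s) := fun s => by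
    simpa only [FreeGroup.lift_apply_of] using hβ (FreeGroup.of s)
  simp only [cupPairing, h1, h2]

/-- A group with a standard presentation of a surface with nonempty boundary carries primitives. -/
theorem IsStandardPresentation.exists_isCupPrimitive {g b : ℕ} {v : Gen g (b + 1) → Γ}
    (hv : IsStandardPresentation v) (hα : IsAdCocycle ρ α) (hβ : IsAdCocycle ρ β) :
    ∃ f, IsCupPrimitive α β f := by
  classical
  -- The exponent sum of the last boundary generator is `1` on the relator. A multiple of it, being
  -- additive, corrects the Fox primitive to one that vanishes there; without a boundary generator
  -- every additive function kills the relator.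
  let e : FreeGroup (Gen g (b + 1)) →* Multiplicative ℝ :=
    FreeGroup.lift fun t => Multiplicative.ofAdd (if t = Gen.z (Fin.last b) then (1 : ℝ) else 0)
  have he : ∀ u w, (e (u * w)).toAdd = (e u).toAdd + (e w).toAdd := fun u w => by
    rw [map_mul, toAdd_mul]
  have heR : (e (surfaceRelator g (b + 1))).toAdd = 1 :=
    (additive_relator (f := fun w => (e w).toAdd) he).trans (by simp [e])
  let φ₀ : FreeGroup (Gen g (b + 1)) → ℝ := fun w =>
    ∑ s, trForm n (barEval v α (foxDeriv s w)) (β (v s))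
  let φ : FreeGroup (Gen g (b + 1)) → ℝ := fun w =>
    φ₀ w - φ₀ (surfaceRelator g (b + 1)) * (e w).toAdd
  have hφ : ∀ u w, φ (u * w) = φ u + φ w +
      trForm n (α (FreeGroup.lift v u)⁻¹) (β (FreeGroup.lift v w)) := fun u w => by
    have h := sum_fox_mul v ρ hα hβ u w
    simp only [φ, φ₀] at h ⊢
    rw [h, he]
    ring
  have hφR : φ (surfaceRelator g (b + 1)) = 0 := by simp only [φ, heR]; ring
  have hl : ∀ u w, FreeGroup.lift v u = 1 → φ (u * w) = φ u + φ w := fun u w h => by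
    rw [hφ, h, inv_one, hα.map_one, map_zero, LinearMap.zero_apply, add_zero]
  have hr : ∀ u w, FreeGroup.lift v w = 1 → φ (u * w) = φ u + φ w := fun u w h => by
    rw [hφ, h, hβ.map_one, map_zero, add_zero]
  have hφ1 : φ 1 = 0 := by simpa using hl 1 1 (map_one _)
  -- The 2-cocycle vanishes if one entry is trivial in `Γ`, so `φ` is additive as soon as one factor
  -- is. Hence its zeros among the trivial words form a normal subgroup; it contains the relator, so
  -- it is the whole kernel and `φ` descends to `Γ`.
  let N : Subgroup (FreeGroup (Gen g (b + 1))) :=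
    { carrier := {w | FreeGroup.lift v w = 1 ∧ φ w = 0}
      one_mem' := ⟨map_one _, hφ1⟩
      mul_mem' := fun {u w} hu hw =>
        ⟨by rw [map_mul, hu.1, hw.1, one_mul], by rw [hl u w hu.1, hu.2, hw.2, add_zero]⟩
      inv_mem' := fun {u} hu =>
        ⟨by rw [map_inv, hu.1, inv_one], by
          have h := hl u u⁻¹ hu.1
          rw [mul_inv_cancel, hφ1, hu.2] at h
          linarith⟩ }
  have hN : N.Normal := ⟨fun u hu w => ⟨by rw [map_mul, map_mul, hu.1, mul_one, map_inv,
      mul_inv_cancel], by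
    have h1 := hl (w * u * w⁻¹) w (by rw [map_mul, map_mul, hu.1, mul_one, map_inv,
      mul_inv_cancel])
    rw [inv_mul_cancel_right, hr w u hu.1, hu.2] at h1
    linarith⟩⟩
  have hker : ∀ u, FreeGroup.lift v u = 1 → φ u = 0 := fun u hu => by
    have h1 : u ∈ (FreeGroup.lift v).ker := hu
    rw [hv.2] at h1
    exact (Subgroup.normalClosure_le_normal (N := N)
      (Set.singleton_subset_iff.2 ⟨hv.lift_relator, hφR⟩) h1).2
  have hwd : ∀ u w, FreeGroup.lift v u = FreeGroup.lift v w → φ u = φ w := fun u w h => by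
    have h1 : FreeGroup.lift v (u * w⁻¹) = 1 := by rw [map_mul, map_inv, h, mul_inv_cancel]
    have h2 := hl (u * w⁻¹) w h1
    rwa [inv_mul_cancel_right, hker _ h1, zero_add] at h2
  choose s hs using hv.1
  refine ⟨fun γ => φ (s γ), fun u w => ?_⟩
  simp only
  rw [hwd (s (u * w)) (s u * s w) (by rw [map_mul, hs, hs, hs]), hφ, hs, hs]

end Primitive

/-! ### Loops and free homotopies -/

section Loops

variable {S : Type} [TopologicalSpace S] {U V W : Set S}

theorem Pi1.mk_eq_iff {p : V} {u v : Path p p} : Pi1.mk u = Pi1.mk v ↔ u.Homotopic v :=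
  MulOpposite.op_injective.eq_iff.trans Path.Homotopic.Quotient.eq

theorem Pi1.mk_surjective {p : V} (γ : Pi1 V p) : ∃ u : Path p p, γ = Pi1.mk u := by
  obtain ⟨u, hu⟩ := Path.Homotopic.Quotient.mk_surjective (FundamentalGroup.toPath γ.unop)
  exact ⟨u, MulOpposite.unop_injective hu.symm⟩

theorem Pi1.mk_trans {p : V} (u v : Path p p) : Pi1.mk (u.trans v) = Pi1.mk u * Pi1.mk v := rfl

theorem Pi1.mk_symm {p : V} (u : Path p p) : Pi1.mk u.symm = (Pi1.mk u)⁻¹ := rfl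

theorem Pi1.incl_mk (h : V ⊆ W) {p : V} (u : Path p p) :
    Pi1.incl h p (Pi1.mk u) = Pi1.mk (u.map (continuous_inclusion h)) := rfl

theorem Pi1.incl_self {V : Set S} {p : V} (h : V ⊆ V) (γ : Pi1 V p) : Pi1.incl h p γ = γ := by
  obtain ⟨u, rfl⟩ := Pi1.mk_surjective γ
  rfl

theorem Pi1.inclPath_mk (h : V ⊆ W) {p : V} {q : W} (η : Path (Set.inclusion h p) q)
    (u : Path p p) : Pi1.inclPath h η (Pi1.mk u) =
      Pi1.mk (η.symm.trans ((u.map (continuous_inclusion h)).trans η)) := rfl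

theorem Path.Homotopic.conj_cancel {X : Type} [TopologicalSpace X] {x y z : X} (u : Path x x)
    (μ : Path x y) (lam : Path x z) : (lam.symm.trans (u.trans lam)).Homotopic
      ((lam.symm.trans μ).trans ((μ.symm.trans (u.trans μ)).trans (lam.symm.trans μ).symm)) := by
  rw [← Path.Homotopic.Quotient.eq, Path.trans_symm, Path.symm_symm]
  simp only [Path.Homotopic.Quotient.mk_trans, Path.Homotopic.Quotient.mk_symm,
    Path.Homotopic.Quotient.trans_assoc]
  simp only [← Path.Homotopic.Quotient.trans_assoc, Path.Homotopic.Quotient.trans_symm,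
    Path.Homotopic.Quotient.refl_trans]

/-- By periodicity the two vertical sides of the homotopy square are the same path `μ`, the track of
the base point; the square then gives `u μ ≃ μ v`. -/
theorem Path.Homotopic.exists_of_freeHomotopy (K : ℝ → ℝ → S)
    (hK : ContinuousOn (Function.uncurry K) (Set.univ ×ˢ Set.Icc 0 1))
    (hper : ∀ t ∈ Set.Icc (0 : ℝ) 1, K 1 t = K 0 t)
    (hW : ∀ s, ∀ t ∈ Set.Icc (0 : ℝ) 1, K s t ∈ W) {x y : W} (u : Path x x) (v : Path y y)
    (hu : ∀ s : unitInterval, (u s : S) = K s 0) (hv : ∀ s : unitInterval, (v s : S) = K s 1) :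
    ∃ μ : Path x y, v.Homotopic (μ.symm.trans (u.trans μ)) := by
  let F : ContinuousMap.Homotopy u.toContinuousMap v.toContinuousMap :=
    { toFun := fun z => ⟨K z.2 z.1, hW _ _ z.1.2⟩
      continuous_toFun := by
        refine Continuous.subtype_mk ?_ _
        refine hK.comp_continuous (f := fun z : unitInterval × unitInterval =>
          ((z.2 : ℝ), (z.1 : ℝ))) (by fun_prop) fun z => ⟨trivial, z.1.2⟩
      map_zero_left := fun s => Subtype.ext (hu s).symm
      map_one_left := fun s => Subtype.ext (hv s).symm }
  have h := Path.Homotopic.map_trans_evalAt F (Path.id : Path (0 : unitInterval) 1)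
  let μ : Path x y := (F.evalAt 0).cast u.source.symm v.source.symm
  have hμ1 : (F.evalAt 1).cast u.target.symm v.target.symm = μ := by
    ext t
    exact hper _ t.2
  refine ⟨μ, ?_⟩
  have h2 : (u.trans μ).Homotopic (μ.trans v) := by
    have h' := h.pathCast u.source.symm v.target.symm
    have e1 : u.trans μ = (((Path.id : Path (0 : unitInterval) 1).map
        (map_continuous u.toContinuousMap)).trans (F.evalAt 1)).cast u.source.symm
        v.target.symm := by
      rw [← hμ1]
      ext t
      simp [Path.trans_apply]
    have e2 : μ.trans v = ((F.evalAt 0).trans ((Path.id : Path (0 : unitInterval) 1).map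
        (map_continuous v.toContinuousMap))).cast u.source.symm v.target.symm := by
      ext t
      simp [Path.trans_apply]
      rfl
    rwa [e1, e2]
  rw [← Path.Homotopic.Quotient.eq] at h2 ⊢
  simp only [Path.Homotopic.Quotient.mk_trans, Path.Homotopic.Quotient.mk_symm] at h2 ⊢
  rw [h2, ← Path.Homotopic.Quotient.trans_assoc, Path.Homotopic.Quotient.symm_trans,
    Path.Homotopic.Quotient.refl_trans]

/-- `γ ∈ π₁(W, p)` is the class of the closed curve `c` in `W`, moved along some path from `c 0` to
`p`. -/
def Represents (W : Set S) (p : W) (c : ℝ → S) (γ : Pi1 W p) : Prop :=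
  ∃ (x : W) (u : Path x x) (μ : Path x p), (∀ s : unitInterval, (u s : S) = c s) ∧
    γ = Pi1.mk (μ.symm.trans (u.trans μ))

/-- The parametrized loop is determined by `c`; only the path to the base point is a choice, and two
such paths differ by a loop. -/
theorem Represents.exists_conj {p : W} {c : ℝ → S} {γ γ' : Pi1 W p} (h : Represents W p c γ)
    (h' : Represents W p c γ') : ∃ g, γ' = g * γ * g⁻¹ := by
  obtain ⟨x, u, μ, hu, rfl⟩ := h
  obtain ⟨x', u', μ', hu', rfl⟩ := h'
  have hx : x' = x := by
    rw [← u.source, ← u'.source]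
    exact Subtype.ext ((hu' 0).trans (hu 0).symm)
  subst hx
  have : u' = u := by
    ext s
    exact (hu' s).trans (hu s).symm
  subst this
  refine ⟨Pi1.mk (μ'.symm.trans μ), ?_⟩
  rw [← Pi1.mk_symm, mul_assoc, ← Pi1.mk_trans, ← Pi1.mk_trans, Pi1.mk_eq_iff]
  exact Path.Homotopic.conj_cancel _ _ _

theorem exists_represents {p : W} {c : ℝ → S} (hc : Continuous c) (h1 : c 1 = c 0)
    (hW : ∀ s, c s ∈ W) (μ : JoinedIn W (c 0) p) : ∃ γ, Represents W p c γ := by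
  obtain ⟨μ⟩ := (joinedIn_iff_joined (hW 0) p.2).1 μ
  let u : Path (⟨c 0, hW 0⟩ : W) ⟨c 0, hW 0⟩ :=
    { toFun := fun s => ⟨c s, hW s⟩
      continuous_toFun := by fun_prop
      source' := rfl
      target' := Subtype.ext h1 }
  exact ⟨_, _, u, μ, fun _ => rfl, rfl⟩

theorem Represents.reverse {p : W} {c : ℝ → S} (hc : ∀ s, c (s + 1) = c s) {γ : Pi1 W p}
    (h : Represents W p c γ) : Represents W p (reverseCurve c) γ⁻¹ := by
  obtain ⟨x, u, μ, hu, rfl⟩ := h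
  refine ⟨x, u.symm, μ, fun s => ?_, ?_⟩
  · rw [Path.symm_apply, Function.comp_apply, hu, unitInterval.coe_symm_eq, reverseCurve, ← hc (-s)]
    congr 1
    ring
  · rw [← Pi1.mk_symm, Path.trans_symm, Path.trans_symm, Path.symm_symm, Pi1.mk_eq_iff,
      ← Path.Homotopic.Quotient.eq]
    simp only [Path.Homotopic.Quotient.mk_trans, Path.Homotopic.Quotient.trans_assoc]

/-- Freely homotopic closed curves represent the same elements. -/
theorem Represents.of_freeHomotopy {p : W} {K : ℝ → ℝ → S}
    (hK : ContinuousOn (Function.uncurry K) (Set.univ ×ˢ Set.Icc 0 1))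
    (hper : ∀ t ∈ Set.Icc (0 : ℝ) 1, K 1 t = K 0 t)
    (hW : ∀ s, ∀ t ∈ Set.Icc (0 : ℝ) 1, K s t ∈ W) {c : ℝ → S} (hc : ∀ s, K s 1 = c s)
    {γ : Pi1 W p} (h : Represents W p c γ) : Represents W p (fun s => K s 0) γ := by
  obtain ⟨x, v, μ, hv, rfl⟩ := h
  let u : Path (⟨K 0 0, hW 0 0 (by simp)⟩ : W) ⟨K 0 0, hW 0 0 (by simp)⟩ :=
    { toFun := fun s => ⟨K s 0, hW s 0 (by simp)⟩
      continuous_toFun := by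
        refine Continuous.subtype_mk ?_ _
        exact hK.comp_continuous (f := fun s : unitInterval => ((s : ℝ), (0 : ℝ))) (by fun_prop)
          fun z => ⟨trivial, by simp⟩
      source' := rfl
      target' := Subtype.ext (hper 0 (by simp)) }
  obtain ⟨lam, hlam⟩ := Path.Homotopic.exists_of_freeHomotopy K hK hper hW u v (fun _ => rfl)
    fun s => (hv s).trans (hc s).symm
  refine ⟨_, u, lam.trans μ, fun _ => rfl, ?_⟩
  rw [Pi1.mk_eq_iff]
  rw [← Path.Homotopic.Quotient.eq] at hlam ⊢
  simp only [Path.Homotopic.Quotient.mk_trans, Path.Homotopic.Quotient.mk_symm, hlam,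
    Path.Homotopic.Quotient.trans_assoc, Path.trans_symm]

theorem Represents.inclPath (h : V ⊆ W) {p : V} {q : W} {c : ℝ → S} {γ : Pi1 V p}
    (η : Path (Set.inclusion h p) q) (hγ : Represents W (Set.inclusion h p) c (Pi1.incl h p γ)) :
    Represents W q c (Pi1.inclPath h η γ) := by
  obtain ⟨x, u, μ, hu, hμ⟩ := hγ
  obtain ⟨v, rfl⟩ := Pi1.mk_surjective γ
  refine ⟨x, u, μ.trans η, hu, ?_⟩
  rw [Pi1.incl_mk, Pi1.mk_eq_iff] at hμ
  rw [Pi1.inclPath_mk, Pi1.mk_eq_iff]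
  rw [← Path.Homotopic.Quotient.eq] at hμ ⊢
  simp only [Path.Homotopic.Quotient.mk_trans, hμ, Path.Homotopic.Quotient.mk_symm,
    Path.Homotopic.Quotient.trans_assoc, Path.trans_symm]

theorem Represents.incl (h : V ⊆ W) {p : V} {c : ℝ → S} {γ : Pi1 V p}
    (hγ : Represents V p c γ) : Represents W (Set.inclusion h p) c (Pi1.incl h p γ) := by
  obtain ⟨x, u, μ, hu, rfl⟩ := hγ
  refine ⟨_, u.map (continuous_inclusion h), μ.map (continuous_inclusion h), hu, ?_⟩
  rw [Pi1.incl_mk, Path.map_trans, Path.map_trans, Path.map_symm]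

/-- If `π₁(W) → π₁(S)` is onto, paths in `S` can be deformed into `W`. -/
theorem Pi1.exists_inclPath_eq (h : V ⊆ W) {q : V} {p : W} (hj : JoinedIn W q p)
    (hsurj : Function.Surjective (Pi1.incl (Set.subset_univ W) p))
    (η : Path (Set.inclusion (Set.subset_univ V) q) (Set.inclusion (Set.subset_univ W) p)) :
    ∃ lam : Path (Set.inclusion h q) p, ∀ γ : Pi1 V q,
      Pi1.incl (Set.subset_univ W) p (Pi1.inclPath h lam γ) =
        Pi1.inclPath (Set.subset_univ V) η γ := by
  obtain ⟨μ⟩ := (joinedIn_iff_joined (h q.2) p.2).1 hj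
  have hi := continuous_inclusion (Set.subset_univ W)
  let μ' : Path (Set.inclusion (Set.subset_univ V) q) (Set.inclusion (Set.subset_univ W) p) :=
    μ.map hi
  -- The path `μ` inside `W` differs from `η` by a loop of `S`; surjectivity replaces that loop by
  -- one in `W`, which is appended to `μ`.
  obtain ⟨g, hg⟩ := hsurj (Pi1.mk (μ'.symm.trans η))
  obtain ⟨w, rfl⟩ := Pi1.mk_surjective g
  rw [Pi1.incl_mk, Pi1.mk_eq_iff] at hg
  let lam : Path (Set.inclusion h q) p := Path.trans μ w
  have hlam : Path.Homotopic (lam.map hi) η := by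
    rw [← Path.Homotopic.Quotient.eq] at hg ⊢
    simp only [lam, Path.map_trans, Path.Homotopic.Quotient.mk_trans]
    erw [hg]
    rw [Path.Homotopic.Quotient.mk_trans]
    rw [Path.Homotopic.Quotient.mk_symm]
    erw [← Path.Homotopic.Quotient.trans_assoc, Path.Homotopic.Quotient.trans_symm,
      Path.Homotopic.Quotient.refl_trans]
  refine ⟨lam, fun γ => ?_⟩
  obtain ⟨u, rfl⟩ := Pi1.mk_surjective γ
  rw [Pi1.inclPath_mk, Pi1.inclPath_mk, Pi1.incl_mk, Path.map_trans, Path.map_trans,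
    ← Path.map_symm, Pi1.mk_eq_iff]
  exact Path.Homotopic.hcomp (Path.Homotopic.symm₂ hlam) (Path.Homotopic.hcomp (.refl _) hlam)

end Loops

/-! ### Punctures -/

theorem EuclideanHalfSpace.exists_pos_mem {G : Set (EuclideanHalfSpace 2)} (hG : IsOpen G)
    (hne : G.Nonempty) : ∃ y ∈ G, 0 < y.1 0 := by
  obtain ⟨y, hy⟩ := hne
  -- Translation by `|t|` in the normal direction stays in the half plane for every real `t` and
  -- leaves the boundary for `t ≠ 0`.
  let ψ : ℝ → EuclideanHalfSpace 2 := fun t => ⟨y.1 + |t| • EuclideanSpace.single 0 1, by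
    have h := y.2
    simp only [PiLp.add_apply, PiLp.smul_apply, PiLp.single_apply, if_true, smul_eq_mul,
      mul_one]
    positivity⟩
  have hψ : Continuous ψ := by
    refine Continuous.subtype_mk ?_ _
    fun_prop
  have hψ0 : ψ 0 = y := Subtype.ext (by simp [ψ])
  have h1 : ∀ᶠ t in nhds (0 : ℝ), ψ t ∈ G :=
    hψ.continuousAt.eventually (by rw [hψ0]; exact hG.mem_nhds hy)
  obtain ⟨t, ht, ht0⟩ := ((h1.filter_mono (nhdsWithin_le_nhds (s := Set.Ioi 0))).and
    self_mem_nhdsWithin).exists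
  refine ⟨ψ t, ht, ?_⟩
  have h := y.2
  have ht' : 0 < |t| := abs_pos.2 (ne_of_gt ht0)
  simp only [ψ, PiLp.add_apply, PiLp.smul_apply, PiLp.single_apply, if_true, smul_eq_mul,
    mul_one]
  linarith

theorem EuclideanHalfSpace.infinite_of_isOpen {G : Set (EuclideanHalfSpace 2)} (hG : IsOpen G)
    (hne : G.Nonempty) : G.Infinite := by
  obtain ⟨y, hy⟩ := hne
  have : Nontrivial (EuclideanHalfSpace 2) := by
    refine ⟨⟨⟨0, by simp⟩, ⟨EuclideanSpace.single 0 1, by simp⟩, fun h => ?_⟩⟩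
    have := congrArg (fun z : EuclideanHalfSpace 2 => z.1 0) h
    simp at this
  have : T1Space (EuclideanHalfSpace 2) :=
    inferInstanceAs (T1Space {x : EuclideanSpace ℝ (Fin 2) // 0 ≤ x 0})
  have := ConnectedSpace.neBot_nhdsWithin_compl_of_nontrivial_of_t1space y
  exact infinite_of_mem_nhds y (hG.mem_nhds hy)

section Puncture

variable {S : Type} [TopologicalSpace S] [ChartedSpace (EuclideanHalfSpace 2) S]

/-- This supplies the puncture: the open half plane part of a chart contains infinitely many points
of `O`, all of them interior, so finitely many base points can be avoided. -/
theorem exists_interior_notMem_finite [IsManifold (𝓡∂ 2) ∞ S] {O : Set S} (hO : IsOpen O)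
    (hne : O.Nonempty) {s : Set S} (hs : s.Finite) :
    ∃ q ∈ O, q ∈ (𝓡∂ 2).interior S ∧ q ∉ s := by
  obtain ⟨x, hx⟩ := hne
  let e := chartAt (EuclideanHalfSpace 2) x
  have hG : IsOpen (e.target ∩ e.symm ⁻¹' O) := e.isOpen_inter_preimage_symm hO
  obtain ⟨y, hy, hy0⟩ := EuclideanHalfSpace.exists_pos_mem hG
    ⟨e x, e.map_source (mem_chart_source _ x), by
      rw [Set.mem_preimage, e.left_inv (mem_chart_source _ x)]; exact hx⟩
  have hG' : IsOpen (e.target ∩ e.symm ⁻¹' O ∩ {z | 0 < z.1 0}) :=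
    hG.inter (isOpen_lt continuous_const (by fun_prop))
  have hinf := EuclideanHalfSpace.infinite_of_isOpen hG' ⟨y, hy, hy0⟩
  have hinj : Set.InjOn e.symm (e.target ∩ e.symm ⁻¹' O ∩ {z | 0 < z.1 0}) :=
    e.symm.injOn.mono fun z hz => hz.1.1
  obtain ⟨_, ⟨⟨z, hz, rfl⟩, hzs⟩⟩ := ((hinf.image hinj).sdiff hs).nonempty
  refine ⟨e.symm z, hz.1.2, ?_, hzs⟩
  have hsrc : e.symm z ∈ e.source := e.map_target hz.1.1
  refine ((𝓡∂ 2).isInteriorPoint_iff_of_mem_atlas (n := ∞) (by simp)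
    (chart_mem_atlas _ x) hsrc).2 ?_
  have : (e.extend (𝓡∂ 2)) (e.symm z) = (𝓡∂ 2) z := by
    rw [OpenPartialHomeomorph.extend_coe, Function.comp_apply, e.right_inv hz.1.1]
  rw [this]
  refine OpenPartialHomeomorph.mem_interior_extend_target _ hz.1.1 ?_
  rw [range_modelWithCornersEuclideanHalfSpace, interior_halfSpace]
  exact hz.2

/-- The homotopy lies in `V` only after time `0`. In a larger `W` that also contains the curve, it
is an honest free homotopy. -/
theorem IsPushOff.represents {V W : Set S} (h : V ⊆ W) {p : V} {c : ℝ → S} {γ : Pi1 V p}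
    (hγ : IsPushOff V p c γ) (hc : ∀ s, c s ∈ W) :
    Represents W (Set.inclusion h p) c (Pi1.incl h p γ) := by
  obtain ⟨H, hH, hper, h0, hV, -, u, hu, rfl⟩ := hγ
  have hW : ∀ s, ∀ t ∈ Set.Icc (0 : ℝ) 1, H s t ∈ W := fun s t ht => by
    rcases ht.1.eq_or_lt with rfl | ht0
    · rw [h0]; exact hc s
    · exact h (hV s t ⟨ht0, ht.2⟩)
  have hH0 : c = fun s => H s 0 := funext fun s => (h0 s).symm
  rw [hH0]
  refine Represents.of_freeHomotopy hH (fun t ht => by simpa using hper 0 t ht) hW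
    (c := fun s => H s 1) (fun _ => rfl) ?_
  refine ⟨_, u.map (continuous_inclusion h), Path.refl _, hu, ?_⟩
  rw [Pi1.incl_mk, Pi1.mk_eq_iff, ← Path.Homotopic.Quotient.eq]
  simp [Path.refl_symm]

theorem IsPushOff.represents_self {p : (Set.univ : Set S)} {c : ℝ → S} {γ : Pi1 Set.univ p}
    (h : IsPushOff Set.univ p c γ) : Represents Set.univ p c γ := by
  have h1 := h.represents subset_rfl fun _ => trivial
  rwa [Pi1.incl_self] at h1

/-- The presentations of the surface and of the piece around `q` may cut out discs of different
radii; concentric circles are freely homotopic off `q`. -/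
theorem smallCircle_represents {q : S} {r r' : ℝ} (hr : 0 < r) (hr' : 0 < r')
    (hb : Metric.closedBall (extChartAt (𝓡∂ 2) q q) r ⊆ (extChartAt (𝓡∂ 2) q).target)
    (hb' : Metric.closedBall (extChartAt (𝓡∂ 2) q q) r' ⊆ (extChartAt (𝓡∂ 2) q).target)
    {p : (Set.univ \ {q} : Set S)} {γ : Pi1 (Set.univ \ {q}) p}
    (hγ : Represents (Set.univ \ {q}) p (smallCircle q r) γ) :
    Represents (Set.univ \ {q}) p (smallCircle q r') γ := by
  let ν : ℝ → EuclideanSpace ℝ (Fin 2) := fun s =>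
    !₂[Real.cos (2 * Real.pi * s), -Real.sin (2 * Real.pi * s)]
  have hν : Continuous ν := by fun_prop
  have hν1 : ∀ s, ‖ν s‖ = 1 := fun s => by
    simp [ν, EuclideanSpace.norm_eq, Fin.sum_univ_two, Real.cos_sq_add_sin_sq]
  let φ := extChartAt (𝓡∂ 2) q
  -- The radius runs from `r'` at time `0` to `r` at time `1`, since `Represents.of_freeHomotopy`
  -- transports from time `1` back to time `0`.
  let L : ℝ × ℝ → EuclideanSpace ℝ (Fin 2) := fun z => φ q + (r' + z.2 * (r - r')) • ν z.1
  have hL : Continuous L := by fun_prop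
  have hLt : ∀ s, ∀ t ∈ Set.Icc (0 : ℝ) 1, L (s, t) ∈ φ.target ∧ L (s, t) ≠ φ q := by
    intro s t ht
    have hpos : 0 < r' + t * (r - r') := by
      rcases ht.1.eq_or_lt with rfl | h0
      · simpa using hr'
      · nlinarith [mul_pos h0 hr, mul_nonneg (sub_nonneg.2 ht.2) hr'.le]
    have hd : dist (L (s, t)) (φ q) = r' + t * (r - r') := by
      simp only [L, dist_eq_norm, add_sub_cancel_left, norm_smul, hν1, mul_one, Real.norm_eq_abs,
        abs_of_pos hpos]
    refine ⟨?_, fun h => ?_⟩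
    · rcases le_total r r' with h | h
      · exact hb' (Metric.mem_closedBall.2 (hd.le.trans (by nlinarith [ht.1])))
      · exact hb (Metric.mem_closedBall.2 (hd.le.trans (by nlinarith [ht.2])))
    · rw [h, dist_self] at hd
      exact hpos.ne hd
  have h := Represents.of_freeHomotopy (W := Set.univ \ {q}) (K := fun s t => φ.symm (L (s, t)))
    (c := smallCircle q r) (γ := γ)
    ((continuousOn_extChartAt_symm q).comp hL.continuousOn fun z hz => (hLt z.1 z.2 hz.2).1)
    (fun t _ => by simp [L, ν])
    (fun s t ht => ⟨trivial, fun h => (hLt s t ht).2 (by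
      rw [← φ.right_inv (hLt s t ht).1]
      exact congrArg φ h)⟩)
    (fun s => by simp only [L, one_mul, add_sub_cancel]; rfl) hγ
  have h' : (fun s => φ.symm (L (s, 0))) = smallCircle q r' := by
    funext s
    simp only [L, zero_mul, add_zero]
    rfl
  rwa [h'] at h

variable [T2Space S] [ConnectedSpace S]

/-- A point of a connected surface with a disc around it does not separate the surface. -/
theorem isPathConnected_compl_point (q : S) {r : ℝ} (hr : 0 < r)
    (hball : Metric.closedBall (extChartAt (𝓡∂ 2) q q) r ⊆ (extChartAt (𝓡∂ 2) q).target)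
    {p : S} (hp : p ≠ q) : IsPathConnected (Set.univ \ {q} : Set S) := by
  have := ChartedSpace.locallyPathConnectedSpace (EuclideanHalfSpace 2) S
  have hW : IsOpen (Set.univ \ {q} : Set S) := isOpen_univ.sdiff isClosed_singleton
  let φ := extChartAt (𝓡∂ 2) q
  have hball' : Metric.ball (φ q) r ⊆ φ.target := Metric.ball_subset_closedBall.trans hball
  -- the punctured disc in polar coordinates
  let P : ℝ × EuclideanSpace ℝ (Fin 2) → EuclideanSpace ℝ (Fin 2) := fun z => φ q + z.1 • z.2
  have hP : ∀ z ∈ Set.Ioo 0 r ×ˢ Metric.sphere (0 : EuclideanSpace ℝ (Fin 2)) 1,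
      P z ∈ Metric.ball (φ q) r ∧ P z ≠ φ q := by
    rintro ⟨t, v⟩ ⟨⟨ht0, htr⟩, hv⟩
    have hv1 : ‖v‖ = 1 := by simpa using hv
    refine ⟨?_, fun h => ?_⟩
    · rw [Metric.mem_ball, dist_eq_norm]
      simp only [P, add_sub_cancel_left, norm_smul, hv1, mul_one, Real.norm_eq_abs, abs_of_pos ht0]
      exact htr
    · have h0 : t • v = 0 := by simpa [P] using h
      have := congrArg norm h0
      rw [norm_smul, hv1, mul_one, norm_zero, Real.norm_eq_abs, abs_of_pos ht0] at this
      exact ht0.ne' this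
  have hconn : IsConnected (φ.symm ∘ P ''
      (Set.Ioo 0 r ×ˢ Metric.sphere (0 : EuclideanSpace ℝ (Fin 2)) 1)) := by
    refine IsConnected.image (IsConnected.prod (isConnected_Ioo hr) ?_) _ ?_
    · refine (isPathConnected_sphere ?_ 0 zero_le_one).isConnected
      rw [← Module.finrank_eq_rank]
      simp
    · refine (continuousOn_extChartAt_symm q).comp (by fun_prop) fun z hz => hball' (hP z hz).1
  set D := φ.symm ∘ P '' (Set.Ioo 0 r ×ˢ Metric.sphere (0 : EuclideanSpace ℝ (Fin 2)) 1) with hD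
  have hDW : D ⊆ Set.univ \ {q} := by
    rintro _ ⟨z, hz, rfl⟩
    refine ⟨trivial, fun h => (hP z hz).2 ?_⟩
    rw [← φ.right_inv (hball' (hP z hz).1)]
    exact congrArg φ h
  obtain ⟨a, ha⟩ := hconn.nonempty
  have hDC : D ⊆ connectedComponentIn (Set.univ \ {q}) a :=
    hconn.isPreconnected.subset_connectedComponentIn ha hDW
  -- The punctured disc is connected, so it lies in one component of the complement of `q`. That
  -- component together with `q` is then open and closed, hence everything.
  have hnhds : insert q (connectedComponentIn (Set.univ \ {q}) a) ∈ nhds q := by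
    have h1 : φ ⁻¹' Metric.ball (φ q) r ∈ nhds q :=
      (continuousAt_extChartAt q).preimage_mem_nhds (Metric.ball_mem_nhds _ hr)
    filter_upwards [h1, extChartAt_source_mem_nhds (I := 𝓡∂ 2) q] with x hx hxs
    by_cases hxq : x = q
    · exact Or.inl hxq
    · refine Or.inr (hDC ⟨(‖φ x - φ q‖, ‖φ x - φ q‖⁻¹ • (φ x - φ q)), ⟨⟨?_, ?_⟩, ?_⟩, ?_⟩)
      · refine norm_pos_iff.2 (sub_ne_zero.2 fun h => hxq ?_)
        exact φ.injOn hxs (mem_extChartAt_source q) h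
      · simpa [dist_eq_norm] using hx
      · have h : φ x - φ q ≠ 0 := sub_ne_zero.2 fun h =>
          hxq (φ.injOn hxs (mem_extChartAt_source q) h)
        simp [norm_smul, h]
      · have h : ‖φ x - φ q‖ ≠ 0 := norm_ne_zero_iff.2 (sub_ne_zero.2 fun h =>
          hxq (φ.injOn hxs (mem_extChartAt_source q) h))
        simp only [P, Function.comp_apply, smul_smul, mul_inv_cancel₀ h, one_smul,
          add_sub_cancel]
        exact φ.left_inv hxs
  have hopen : IsOpen (insert q (connectedComponentIn (Set.univ \ {q}) a)) := by
    rw [isOpen_iff_mem_nhds]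
    rintro x (rfl | hx)
    · exact hnhds
    · exact Filter.mem_of_superset (hW.connectedComponentIn.mem_nhds hx) (Set.subset_insert _ _)
  have hclosed : IsClosed (insert q (connectedComponentIn (Set.univ \ {q}) a)) := by
    rw [← isOpen_compl_iff, isOpen_iff_mem_nhds]
    intro x hx
    have hx' : x ∉ insert q (connectedComponentIn (Set.univ \ {q}) a) := hx
    rw [Set.mem_insert_iff, not_or] at hx'
    have hxW : x ∈ (Set.univ \ {q} : Set S) := ⟨trivial, hx'.1⟩
    refine Filter.mem_of_superset (hW.connectedComponentIn.mem_nhds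
      (mem_connectedComponentIn hxW)) fun y hy => ?_
    rintro (rfl | hya)
    · exact (connectedComponentIn_subset _ _ hy).2 rfl
    · refine hx'.2 ?_
      rw [connectedComponentIn_eq hya, ← connectedComponentIn_eq hy]
      exact mem_connectedComponentIn hxW
  have huniv := IsClopen.eq_univ ⟨hclosed, hopen⟩ ⟨q, Set.mem_insert _ _⟩
  rw [← hW.isConnected_iff_isPathConnected]
  have : (Set.univ \ {q} : Set S) = connectedComponentIn (Set.univ \ {q}) a := by
    refine Set.Subset.antisymm (fun x hx => ?_) (connectedComponentIn_subset _ _)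
    have : x ∈ insert q (connectedComponentIn (Set.univ \ {q}) a) := by
      rw [huniv]; trivial
    exact this.resolve_left hx.2
  rw [this]
  exact isConnected_connectedComponentIn_iff.2 (hDW ha)

end Puncture

/-! ### Pushing curves into the complement of a curve system -/

theorem Function.Periodic.apply_fract {X : Type} {f : ℝ → X} (h : Function.Periodic f 1) (s : ℝ) :
    f (Int.fract s) = f s := by
  have := h.sub_int_mul_eq (x := s) ⌊s⌋
  rwa [mul_one] at this

section PushOff

variable {S : Type} [TopologicalSpace S]

/-- A periodic homotopy that starts in an open set stays there for some time. -/
theorem exists_homotopy_subset {H : ℝ → ℝ → S} {δ : ℝ} (hδ : 0 < δ)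
    (hH : ContinuousOn (Function.uncurry H) (Set.univ ×ˢ Set.Icc 0 δ))
    (hper : ∀ s, ∀ t ∈ Set.Icc (0 : ℝ) δ, H (s + 1) t = H s t) {N : Set S} (hN : IsOpen N)
    (h0 : ∀ s, H s 0 ∈ N) : ∃ ε ∈ Set.Ioo 0 δ, ∀ s, ∀ t ∈ Set.Icc (0 : ℝ) ε, H s t ∈ N := by
  obtain ⟨O, hO, hOeq⟩ := (continuousOn_iff'.1 hH) N hN
  have hsub : Set.Icc (0 : ℝ) 1 ×ˢ ({0} : Set ℝ) ⊆ O := by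
    rintro ⟨s, t⟩ ⟨-, ht⟩
    obtain rfl : t = 0 := ht
    have : (s, (0 : ℝ)) ∈ Function.uncurry H ⁻¹' N ∩ Set.univ ×ˢ Set.Icc 0 δ :=
      ⟨h0 s, trivial, le_rfl, hδ.le⟩
    rw [hOeq] at this
    exact this.1
  -- The tube lemma over one compact period gives a uniform time; periodicity extends it to all `s`.
  obtain ⟨u, v, -, hv, hu1, hv0, huv⟩ :=
    generalized_tube_lemma isCompact_Icc isCompact_singleton hO hsub
  obtain ⟨ρ, hρ, hball⟩ := Metric.isOpen_iff.1 hv 0 (hv0 rfl)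
  have hmin : 0 < min ρ δ := lt_min hρ hδ
  refine ⟨min ρ δ / 2, ⟨by linarith, by linarith [min_le_right ρ δ]⟩, fun s t ht => ?_⟩
  have htδ : t ∈ Set.Icc 0 δ := ⟨ht.1, by linarith [ht.2, min_le_right ρ δ]⟩
  have hp : Function.Periodic (fun s => H s t) 1 := fun s => hper s t htδ
  rw [← hp.apply_fract s]
  have hmem : (Int.fract s, t) ∈ O := by
    refine huv ⟨hu1 ⟨Int.fract_nonneg s, (Int.fract_lt_one s).le⟩, hball ?_⟩
    rw [Metric.mem_ball, dist_zero_right, Real.norm_eq_abs, abs_of_nonneg ht.1]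
    linarith [ht.2, min_le_left ρ δ]
  have : (Int.fract s, t) ∈ Function.uncurry H ⁻¹' N ∩ Set.univ ×ˢ Set.Icc 0 δ := by
    rw [hOeq]
    exact ⟨hmem, trivial, htδ⟩
  exact this.1

variable [ChartedSpace (EuclideanHalfSpace 2) S]

/-- The homotopy `H` pushes `c` to its left into `V` during the time interval `[0, ε]`. -/
structure PushesInto (V : Set S) (c : ℝ → S) (ε : ℝ) (H : ℝ → ℝ → S) : Prop where
  continuousOn : ContinuousOn (Function.uncurry H) (Set.univ ×ˢ Set.Icc 0 ε)
  periodic : ∀ s, ∀ t ∈ Set.Icc (0 : ℝ) ε, H (s + 1) t = H s t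
  start : ∀ s, H s 0 = c s
  mem : ∀ s, ∀ t ∈ Set.Ioc (0 : ℝ) ε, H s t ∈ V
  positive : ∀ s, IsPositiveBasis (velocity c s)
    (mfderivWithin 𝓘(ℝ, ℝ) (𝓡∂ 2) (H s) (Set.Icc 0 1) 0 (1 : ℝ))

/-- Only the first moments of a push-off matter. The curve reached at time `ε` is then dragged along
a path in `V` until it is based at `p`. -/
theorem PushesInto.exists_isPushOff {V : Set S} {c : ℝ → S} {ε : ℝ} {H : ℝ → ℝ → S}
    (h : PushesInto V c ε H) (hε : 0 < ε) (hε1 : ε < 1) (p : V) (hj : JoinedIn V (H 0 ε) p) :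
    ∃ γ, IsPushOff V p c γ := by
  obtain ⟨lam, hlam⟩ := hj
  have hεε : ε ∈ Set.Icc 0 ε := ⟨hε.le, le_rfl⟩
  have hp : Function.Periodic (fun s => H s ε) 1 := fun s => h.periodic s ε hεε
  have hHε : Continuous fun s => H s ε :=
    h.continuousOn.comp_continuous (f := fun s : ℝ => (s, ε)) (by fun_prop)
      fun s => ⟨trivial, hεε⟩
  have hlamV : ∀ t, lam.extend t ∈ V := fun t => hlam _
  -- On `[-1, 2]` this runs from `p` back along `lam`, once around the curve at time `ε`, and out
  -- along `lam` to `p`.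
  let w : ℝ → S := fun s => if s ≤ 0 then lam.extend (-s) else
    if s ≤ 1 then H s ε else lam.extend (s - 1)
  have hw : Continuous w := by
    refine Continuous.if_le (by fun_prop) (Continuous.if_le hHε (by fun_prop) continuous_id
      continuous_const fun s hs => ?_) continuous_id continuous_const fun s hs => ?_
    · have := hp 0
      simp only [zero_add] at this
      simp [hs, this]
    · simp [hs]
  have hwV : ∀ s, w s ∈ V := fun s => by
    simp only [w]
    split_ifs
    exacts [hlamV _, h.mem s ε ⟨hε, le_rfl⟩, hlamV _]
  let τ : ℝ → ℝ := fun t => max 0 ((t - ε) / (1 - ε))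
  have hτ : Continuous τ := by fun_prop
  have hτ0 : ∀ t, 0 ≤ τ t := fun t => le_max_left _ _
  have hτ1 : τ 1 = 1 := by simp [τ, div_self (sub_ne_zero.2 hε1.ne')]
  have hends : ∀ t, 0 ≤ t → w (0 * (1 + 2 * t) - t) = w (1 * (1 + 2 * t) - t) := fun t ht => by
    rcases ht.eq_or_lt with rfl | ht
    · have := hp 0
      simp only [zero_add] at this
      simp [w, this]
    · have h1 : ¬ (1 * (1 + 2 * t) - t ≤ 0) := by linarith
      have h2 : ¬ (1 * (1 + 2 * t) - t ≤ 1) := by linarith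
      have h3 : 0 * (1 + 2 * t) - t ≤ 0 := by linarith
      simp only [w, if_pos h3, if_neg h1, if_neg h2]
      congr 1
      ring
  -- The loop at time `t` is `w` on the window `[-τ, 1 + τ]`, which grows from `[0, 1]` to `[-1,
  -- 2]`. The values of `w` at the two ends agree, so the periodic extension by `Int.fract` is
  -- continuous.
  let G : ℝ × ℝ → S := fun z => w (Int.fract z.1 * (1 + 2 * τ z.2) - τ z.2)
  have hG : Continuous G :=
    ContinuousOn.comp_fract (f := fun (z : ℝ × ℝ) a => w (a * (1 + 2 * τ z.2) - τ z.2))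
      (s := fun z : ℝ × ℝ => z.1) (by fun_prop) continuous_fst fun z => hends _ (hτ0 _)
  let E : ℝ × ℝ → S := fun z => H z.1 (max 0 (min z.2 ε))
  have hclamp : ∀ t : ℝ, max 0 (min t ε) ∈ Set.Icc 0 ε := fun t =>
    ⟨le_max_left _ _, max_le hε.le (min_le_right _ _)⟩
  have hE : Continuous E :=
    h.continuousOn.comp_continuous (f := fun z : ℝ × ℝ => (z.1, max 0 (min z.2 ε)))
      (by fun_prop) fun z => ⟨trivial, hclamp _⟩
  let H' : ℝ → ℝ → S := fun s t => if t ≤ ε then E (s, t) else G (s, t)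
  have hH' : Continuous (Function.uncurry H') := by
    refine Continuous.if_le hE hG continuous_snd continuous_const fun z hz => ?_
    have hz0 : τ z.2 = 0 := by simp [τ, hz]
    have h1 : w (Int.fract z.1) = H (Int.fract z.1) ε := by
      simp only [w]
      split_ifs with h1 h2
      · have h3 : Int.fract z.1 = 0 := le_antisymm h1 (Int.fract_nonneg _)
        simp [h3]
      · rfl
      · exact absurd (Int.fract_lt_one z.1).le h2
    have h2 : H (Int.fract z.1) ε = H z.1 ε := hp.apply_fract z.1
    have hG0 : G z = H z.1 ε := by
      change w (Int.fract z.1 * (1 + 2 * τ z.2) - τ z.2) = _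
      rw [hz0, mul_zero, add_zero, mul_one, sub_zero, h1, h2]
    change E z = G z
    rw [hG0]
    simp [E, hz, hε.le]
  have hH'eq : ∀ s, ∀ t ∈ Set.Icc 0 ε, H' s t = H s t := fun s t ht => by
    simp [H', E, ht.2, ht.1]
  have hH'p : ∀ s t, H' (s + 1) t = H' s t := fun s t => by
    simp only [H', E, G, Int.fract_add_one]
    rw [h.periodic s _ (hclamp t)]
  have hH'V : ∀ s, ∀ t ∈ Set.Ioc (0 : ℝ) 1, H' s t ∈ V := fun s t ht => by
    by_cases hts : t ≤ ε
    · rw [hH'eq s t ⟨ht.1.le, hts⟩]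
      exact h.mem s t ⟨ht.1, hts⟩
    · simp only [H', if_neg hts]
      exact hwV _
  have hend : ∀ s, s = 0 ∨ s = 1 → H' s 1 = p := fun s hs => by
    have : Int.fract s = 0 := by rcases hs with rfl | rfl <;> simp
    simp [H', not_le.2 hε1, G, hτ1, this, w]
  let u : Path p p :=
    { toFun := fun s => ⟨H' s 1, hH'V _ _ ⟨one_pos, le_rfl⟩⟩
      continuous_toFun := Continuous.subtype_mk
        (hH'.comp (f := fun s : unitInterval => ((s : ℝ), (1 : ℝ))) (by fun_prop)) _
      source' := Subtype.ext (hend _ (Or.inl rfl))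
      target' := Subtype.ext (hend _ (Or.inr rfl)) }
  refine ⟨Pi1.mk u, H', hH'.continuousOn, fun s t _ => hH'p s t, fun s => ?_, hH'V, fun s => ?_,
    u, fun _ => rfl, rfl⟩
  · rw [hH'eq s 0 ⟨le_rfl, hε.le⟩, h.start]
  -- The derivative at time `0` sees only times below `ε`, where the homotopy is unchanged.
  · have : mfderivWithin 𝓘(ℝ, ℝ) (𝓡∂ 2) (H' s) (Set.Icc 0 1) 0 =
        mfderivWithin 𝓘(ℝ, ℝ) (𝓡∂ 2) (H s) (Set.Icc 0 1) 0 := by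
      refine Filter.EventuallyEq.mfderivWithin_eq ?_ (hH'eq s 0 ⟨le_rfl, hε.le⟩)
      filter_upwards [self_mem_nhdsWithin, nhdsWithin_le_nhds (Iio_mem_nhds hε)] with t ht1 ht2
      exact hH'eq s t ⟨ht1.1, le_of_lt ht2⟩
    have h2 := h.positive s
    rw [← this] at h2
    exact h2

theorem IsPushOff.exists_pushesInto {V : Set S} {p : V} {c : ℝ → S} {γ : Pi1 V p}
    (h : IsPushOff V p c γ) : ∃ H, PushesInto V c 1 H := by
  obtain ⟨H, hH, hper, h0, hV, hpos, -⟩ := h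
  exact ⟨H, hH, hper, h0, hV, hpos⟩

theorem PushesInto.mono {V W : Set S} {c : ℝ → S} {ε δ : ℝ} {H : ℝ → ℝ → S}
    (h : PushesInto V c ε H) (hδ : δ ≤ ε) (hW : ∀ s, ∀ t ∈ Set.Ioc (0 : ℝ) δ, H s t ∈ W) :
    PushesInto W c δ H where
  continuousOn := h.continuousOn.mono (Set.prod_mono_right (Set.Icc_subset_Icc_right hδ))
  periodic s t ht := h.periodic s t ⟨ht.1, ht.2.trans hδ⟩
  start := h.start
  mem := hW
  positive := h.positive

end PushOff

/-! ### Annuli -/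

section Annulus

variable {S : Type} [TopologicalSpace S] [ChartedSpace (EuclideanHalfSpace 2) S]

namespace IsAnnulus

variable {F : ℝ × ℝ → S} {c : ℝ → S}

theorem contMDiffAt (hF : IsAnnulus F c) {s t : ℝ} (ht : t ∈ Set.Ioo (-1 : ℝ) 1) :
    ContMDiffAt 𝓘(ℝ, ℝ × ℝ) (𝓡∂ 2) ∞ F (s, t) :=
  hF.smooth.contMDiffAt ((isOpen_univ.prod isOpen_Ioo).mem_nhds ⟨trivial, ht⟩)

theorem mdifferentiableAt (hF : IsAnnulus F c) {s t : ℝ} (ht : t ∈ Set.Ioo (-1 : ℝ) 1) :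
    MDifferentiableAt 𝓘(ℝ, ℝ × ℝ) (𝓡∂ 2) F (s, t) :=
  (hF.contMDiffAt ht).mdifferentiableAt (by simp)

theorem velocity_eq (hF : IsAnnulus F c) (s : ℝ) :
    velocity c s = mfderiv 𝓘(ℝ, ℝ × ℝ) (𝓡∂ 2) F (s, 0) ((1, 0) : ℝ × ℝ) := by
  obtain rfl : (fun s => F (s, 0)) = c := funext hF.core
  have h1 : HasFDerivAt (fun s : ℝ => (s, (0 : ℝ))) (ContinuousLinearMap.inl ℝ ℝ ℝ) s :=
    hasFDerivAt_prodMk_left s 0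
  have h2 := HasMFDerivAt.comp s (hF.mdifferentiableAt (s := s) (t := 0) (by simp)).hasMFDerivAt
    h1.hasMFDerivAt
  unfold velocity
  have h3 := h2.mfderiv
  change mfderiv 𝓘(ℝ, ℝ) (𝓡∂ 2) (F ∘ fun s : ℝ => (s, (0 : ℝ))) s (1 : ℝ) = _
  rw [h3]
  rfl

theorem mfderivWithin_eq (hF : IsAnnulus F c) (s : ℝ) :
    (mfderivWithin 𝓘(ℝ, ℝ) (𝓡∂ 2) (fun t => F (s, t)) (Set.Icc 0 1) 0 (1 : ℝ)) =
      mfderiv 𝓘(ℝ, ℝ × ℝ) (𝓡∂ 2) F (s, 0) ((0, 1) : ℝ × ℝ) := by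
  have h1 : HasFDerivAt (fun t : ℝ => (s, t)) (ContinuousLinearMap.inr ℝ ℝ ℝ) 0 :=
    hasFDerivAt_prodMk_right s 0
  have h2 := HasMFDerivAt.comp 0 (hF.mdifferentiableAt (s := s) (t := 0) (by simp)).hasMFDerivAt
    h1.hasMFDerivAt
  have hu : UniqueMDiffWithinAt 𝓘(ℝ, ℝ) (Set.Icc (0 : ℝ) 1) 0 :=
    (uniqueDiffOn_Icc zero_lt_one 0 (by simp)).uniqueMDiffWithinAt
  have h3 := h2.hasMFDerivWithinAt.mfderivWithin hu
  change mfderivWithin 𝓘(ℝ, ℝ) (𝓡∂ 2) (F ∘ fun t : ℝ => (s, t)) (Set.Icc 0 1) 0 (1 : ℝ) = _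
  rw [h3]
  rfl

/-- Positivity of the annulus along its core says exactly that the transverse coordinate pushes the
core to its left. -/
theorem pushesInto (hF : IsAnnulus F c) {V : Set S} {ε : ℝ} (hε : ε < 1)
    (hV : ∀ s, ∀ t ∈ Set.Ioc (0 : ℝ) ε, F (s, t) ∈ V) : PushesInto V c ε fun s t => F (s, t) where
  continuousOn := hF.smooth.continuousOn.mono
    (Set.prod_mono_right fun t ht => ⟨by linarith [ht.1], ht.2.trans_lt hε⟩)
  periodic s t _ := hF.periodic s t
  start := hF.core
  mem := hV
  positive s := by
    have h := hF.positive (s, 0) ⟨trivial, by simp⟩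
    rw [hF.velocity_eq]
    have h2 := hF.mfderivWithin_eq s
    rw [← h2] at h
    exact h

theorem mfderiv_eq_fderiv (hF : IsAnnulus F c) (s : ℝ) :
    mfderiv 𝓘(ℝ, ℝ × ℝ) (𝓡∂ 2) F (s, 0) =
      fderiv ℝ (extChartAt (𝓡∂ 2) (F (s, 0)) ∘ F) (s, 0) := by
  have h := (hF.mdifferentiableAt (s := s) (t := 0) (by simp)).hasMFDerivAt.2
  simp only [writtenInExtChartAt, mfld_simps] at h
  let D : ℝ × ℝ →L[ℝ] EuclideanSpace ℝ (Fin 2) := mfderiv 𝓘(ℝ, ℝ × ℝ) (𝓡∂ 2) F (s, 0)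
  have h' : HasFDerivWithinAt (extChartAt (𝓡∂ 2) (F (s, 0)) ∘ F) D Set.univ (s, 0) := h
  exact (hasFDerivWithinAt_univ.1 h').fderiv.symm

/-- The rotation `(s, t) ↦ (-s, -t)` preserves orientation, so the right side of `c` becomes the
left side of the reversed curve and one argument treats both sides. -/
theorem reverse (hF : IsAnnulus F c) : IsAnnulus (fun z => F (-z.1, -z.2)) (reverseCurve c) where
  smooth := by
    refine hF.smooth.comp (t := Set.univ ×ˢ Set.Ioo (-1) 1) (f := fun z : ℝ × ℝ => (-z.1, -z.2))
      ?_ ?_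
    · exact ContDiff.contMDiff (by fun_prop) |>.contMDiffOn
    · rintro ⟨s, t⟩ ⟨-, ht⟩
      exact ⟨trivial, by simp only; linarith [ht.2], by simp only; linarith [ht.1]⟩
  periodic s t := by
    have := hF.periodic (-(s + 1)) (-t)
    simp only at this ⊢
    rw [← this]
    ring_nf
  core s := by simp [reverseCurve, hF.core]
  injOn := by
    have hp : ∀ s t, F (Int.fract s, t) = F (s, t) := fun s t =>
      Function.Periodic.apply_fract (f := fun s => F (s, t)) (fun s => hF.periodic s t) s
    rintro ⟨s, t⟩ ⟨hs, ht⟩ ⟨s', t'⟩ ⟨hs', ht'⟩ h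
    simp only at h
    rw [← hp (-s), ← hp (-s')] at h
    have h2 := hF.injOn (x₁ := (Int.fract (-s), -t)) (x₂ := (Int.fract (-s'), -t'))
      ⟨⟨Int.fract_nonneg _, Int.fract_lt_one _⟩, by simp only; linarith [ht.2],
        by simp only; linarith [ht.1]⟩
      ⟨⟨Int.fract_nonneg _, Int.fract_lt_one _⟩, by simp only; linarith [ht'.2],
        by simp only; linarith [ht'.1]⟩ h
    rw [Prod.mk.injEq, Int.fract_eq_fract] at h2
    obtain ⟨⟨z, hz⟩, h3⟩ := h2
    have hz0 : z = 0 := by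
      have h4 : -1 < (z : ℝ) := by linarith [hs.2, hs'.1]
      have h5 : (z : ℝ) < 1 := by linarith [hs.1, hs'.2]
      have h4' : -1 < z := by exact_mod_cast h4
      have h5' : z < 1 := by exact_mod_cast h5
      omega
    subst hz0
    rw [Int.cast_zero] at hz
    exact Prod.ext (by simp only; linarith) (by simp only; linarith)
  positive := by
    rintro ⟨s, t⟩ ⟨-, ht⟩
    have ht' : -t ∈ Set.Ioo (-1 : ℝ) 1 := ⟨by linarith [ht.2], by linarith [ht.1]⟩
    have h1 : HasFDerivAt (fun z : ℝ × ℝ => (-z.1, -z.2)) (-ContinuousLinearMap.id ℝ (ℝ × ℝ))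
        (s, t) := (hasFDerivAt_id (𝕜 := ℝ) ((s, t) : ℝ × ℝ)).neg
    have h2 := HasMFDerivAt.comp (s, t)
      (hF.mdifferentiableAt (s := -s) (t := -t) ht').hasMFDerivAt h1.hasMFDerivAt
    have h3 := h2.mfderiv
    have h4 := hF.positive (-s, -t) ⟨trivial, ht'⟩
    have h5 : ∀ v : ℝ × ℝ, (mfderiv 𝓘(ℝ, ℝ × ℝ) (𝓡∂ 2) (fun z : ℝ × ℝ => F (-z.1, -z.2)) (s, t) v :
        EuclideanSpace ℝ (Fin 2)) = -(mfderiv 𝓘(ℝ, ℝ × ℝ) (𝓡∂ 2) F (-s, -t) v :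
          EuclideanSpace ℝ (Fin 2)) := fun v => by
      change mfderiv 𝓘(ℝ, ℝ × ℝ) (𝓡∂ 2) (F ∘ fun z : ℝ × ℝ => (-z.1, -z.2)) (s, t) v = _
      rw [h3]
      exact (mfderiv 𝓘(ℝ, ℝ × ℝ) (𝓡∂ 2) F (-s, -t)).map_neg v
    have h6 := h5 (1, 0)
    have h7 := h5 (0, 1)
    have hneg : ∀ a b : EuclideanSpace ℝ (Fin 2), IsPositiveBasis a b →
        IsPositiveBasis (-a) (-b) := fun a b hab => by
      simpa [IsPositiveBasis] using hab
    erw [h6, h7]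
    exact hneg _ _ h4

/-- A curve pushed off the core of an annulus to the left runs into the left half of the annulus. -/
theorem exists_mem_of_isPushOff (hF : IsAnnulus F c) {V : Set S} {p : V} {γ : Pi1 V p}
    (h : IsPushOff V p c γ) {ε : ℝ} (hε : 0 < ε) : ∃ s, ∃ t ∈ Set.Ioo 0 ε, F (s, t) ∈ V := by
  obtain ⟨H, hH, -, h0, hV, hpos, -⟩ := h
  have hH0 : H 0 0 = F (0, 0) := by rw [h0, hF.core]
  set φ := extChartAt (𝓡∂ 2) (F (0, 0)) with hφ
  set f : ℝ × ℝ → EuclideanSpace ℝ (Fin 2) := φ ∘ F with hf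
  have hcd : ContDiffAt ℝ ∞ f (0, 0) := by
    have := (contMDiffAt_iff.1 (hF.contMDiffAt (s := 0) (t := 0) (by simp))).2
    simp only [mfld_simps] at this
    exact contDiffWithinAt_univ.1 this
  set A := fderiv ℝ f (0, 0) with hA
  have hA1 : velocity c 0 = A (1, 0) := by
    rw [hF.velocity_eq, hF.mfderiv_eq_fderiv]
    rfl
  have hAdet : IsPositiveBasis (A (1, 0)) (A (0, 1)) := by
    have := hF.positive (0, 0) ⟨trivial, by simp⟩
    rwa [hF.mfderiv_eq_fderiv] at this
  have hAlin : ∀ z : ℝ × ℝ, A z = z.1 • A (1, 0) + z.2 • A (0, 1) := fun z => by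
    rw [← map_smul, ← map_smul, ← map_add]
    simp
  unfold IsPositiveBasis at hAdet
  have hinj : Function.Injective A := by
    rw [injective_iff_map_eq_zero]
    intro z hz
    rw [hAlin] at hz
    have e0 := congrArg (fun y : EuclideanSpace ℝ (Fin 2) => y 0) hz
    have e1 := congrArg (fun y : EuclideanSpace ℝ (Fin 2) => y 1) hz
    simp only [PiLp.add_apply, PiLp.smul_apply, smul_eq_mul, PiLp.zero_apply] at e0 e1
    have z1 : z.1 * (A (1, 0) 0 * A (0, 1) 1 - A (1, 0) 1 * A (0, 1) 0) = 0 := by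
      linear_combination A (0, 1) 1 * e0 - A (0, 1) 0 * e1
    have z2 : z.2 * (A (1, 0) 0 * A (0, 1) 1 - A (1, 0) 1 * A (0, 1) 0) = 0 := by
      linear_combination A (1, 0) 0 * e1 - A (1, 0) 1 * e0
    exact Prod.ext ((mul_eq_zero.1 z1).resolve_right hAdet.ne')
      ((mul_eq_zero.1 z2).resolve_right hAdet.ne')
  let A' : (ℝ × ℝ) ≃L[ℝ] EuclideanSpace ℝ (Fin 2) :=
    (LinearEquiv.ofInjectiveOfFinrankEq A.toLinearMap hinj (by simp)).toContinuousLinearEquiv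
  have hA' : (A' : (ℝ × ℝ) →L[ℝ] EuclideanSpace ℝ (Fin 2)) = A := by
    ext z <;> rfl
  -- In a chart the annulus map is locally invertible at `(0, 0)`; its local inverse gives the
  -- pushed path annulus coordinates for small times.
  have hst : HasStrictFDerivAt f (A' : (ℝ × ℝ) →L[ℝ] EuclideanSpace ℝ (Fin 2)) (0, 0) := by
    rw [hA']
    exact hcd.hasStrictFDerivAt (by simp)
  let g := hst.localInverse
  have hg0 : g (f (0, 0)) = (0, 0) := hst.localInverse_apply_image
  have hgd : HasFDerivAt g (A'.symm : EuclideanSpace ℝ (Fin 2) →L[ℝ] ℝ × ℝ) (f (0, 0)) :=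
    hst.to_localInverse.hasFDerivAt
  let B : ℝ →L[ℝ] EuclideanSpace ℝ (Fin 2) :=
    mfderivWithin 𝓘(ℝ, ℝ) (𝓡∂ 2) (H 0) (Set.Icc 0 1) 0
  let w : EuclideanSpace ℝ (Fin 2) := B 1
  have hw : IsPositiveBasis (A (1, 0)) w := by
    rw [← hA1]
    exact hpos 0
  -- Otherwise the derivative has the default value `0`, which is not part of a positive basis.
  have hmd : MDifferentiableWithinAt 𝓘(ℝ, ℝ) (𝓡∂ 2) (H 0) (Set.Icc 0 1) 0 := by
    by_contra hcon
    have h1 : w = 0 := by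
      simp only [w, B]
      rw [mfderivWithin_zero_of_not_mdifferentiableWithinAt hcon]
      rfl
    rw [h1] at hw
    simp [IsPositiveBasis] at hw
  have hhd : HasDerivWithinAt (fun t => φ (H 0 t)) w (Set.Icc 0 1) 0 := by
    have h1 := hmd.hasMFDerivWithinAt.2
    simp only [writtenInExtChartAt, mfld_simps] at h1
    rw [hH0] at h1
    have h2 : HasFDerivWithinAt (fun t => φ (H 0 t)) B (Set.Icc 0 1) 0 := h1
    exact h2.hasDerivWithinAt
  have hf0 : f (0, 0) = φ (H 0 0) := by rw [hH0]; rfl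
  rw [hf0] at hgd hg0
  have hkd : HasDerivWithinAt (fun t => (g (φ (H 0 t))).2) (A'.symm w).2 (Set.Icc 0 1) 0 := by
    have h1 := hgd.comp_hasDerivWithinAt (f := fun t => φ (H 0 t)) 0 hhd
    exact (ContinuousLinearMap.snd ℝ ℝ ℝ).hasFDerivAt.comp_hasDerivWithinAt 0 h1
  -- By bilinearity the determinant of the velocity and the push direction is the transverse
  -- component of the latter times the positive Jacobian of `F`.
  have hkpos : 0 < (A'.symm w).2 := by
    have h1 : A (A'.symm w) = w := by
      rw [← hA']
      exact A'.apply_symm_apply w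
    rw [hAlin] at h1
    unfold IsPositiveBasis at hw
    rw [← h1] at hw
    simp only [PiLp.add_apply, PiLp.smul_apply, smul_eq_mul] at hw
    have h2 : 0 < (A'.symm w).2 * (A (1, 0) 0 * A (0, 1) 1 - A (1, 0) 1 * A (0, 1) 0) := by
      linarith
    exact pos_of_mul_pos_left h2 hAdet.le
  have hIoc : Set.Icc (0 : ℝ) 1 \ {0} = Set.Ioc 0 1 := Set.Icc_sdiff_left
  have hne : (nhdsWithin (0 : ℝ) (Set.Ioc 0 1)).NeBot := by
    rw [nhdsWithin_Ioc_eq_nhdsGT zero_lt_one]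
    infer_instance
  have hle : nhdsWithin (0 : ℝ) (Set.Ioc 0 1) ≤ nhdsWithin 0 (Set.Icc 0 1) :=
    nhdsWithin_mono _ Set.Ioc_subset_Icc_self
  have ev1 : ∀ᶠ t in nhdsWithin (0 : ℝ) (Set.Ioc 0 1), 0 < (g (φ (H 0 t))).2 := by
    have h1 := hasDerivWithinAt_iff_tendsto_slope.1 hkd
    rw [hIoc] at h1
    filter_upwards [h1.eventually_const_lt hkpos, self_mem_nhdsWithin] with t ht ht0
    rw [slope_def_field, hg0, sub_zero, sub_zero] at ht
    exact (div_pos_iff_of_pos_right ht0.1).1 ht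
  have hφc : Filter.Tendsto (fun t => φ (H 0 t)) (nhdsWithin 0 (Set.Ioc 0 1))
      (nhds (φ (H 0 0))) := hhd.continuousWithinAt.mono_left hle
  have hgc : Filter.Tendsto (fun t => g (φ (H 0 t))) (nhdsWithin 0 (Set.Ioc 0 1))
      (nhds ((0, 0) : ℝ × ℝ)) := by
    have := hgd.continuousAt.tendsto.comp hφc
    rwa [hg0] at this
  have ev2 : ∀ᶠ t in nhdsWithin (0 : ℝ) (Set.Ioc 0 1), (g (φ (H 0 t))).2 < ε :=
    ((continuous_snd.tendsto _).comp hgc).eventually_lt_const hε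
  have ev3 : ∀ᶠ t in nhdsWithin (0 : ℝ) (Set.Ioc 0 1), F (g (φ (H 0 t))) ∈ φ.source := by
    have hFc : ContinuousAt F (0, 0) := (hF.contMDiffAt (s := 0) (t := 0) (by simp)).continuousAt
    exact (hFc.tendsto.comp hgc).eventually (extChartAt_source_mem_nhds (I := 𝓡∂ 2) (F (0, 0)))
  have ev4 : ∀ᶠ t in nhdsWithin (0 : ℝ) (Set.Ioc 0 1), f (g (φ (H 0 t))) = φ (H 0 t) := by
    have h1 := hst.eventually_right_inverse
    rw [hf0] at h1
    exact hφc.eventually h1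
  have ev5 : ∀ᶠ t in nhdsWithin (0 : ℝ) (Set.Ioc 0 1), H 0 t ∈ φ.source := by
    have h1 : Filter.Tendsto (H 0) (nhdsWithin 0 (Set.Ioc 0 1)) (nhds (F (0, 0))) := by
      rw [← hH0]
      exact hmd.continuousWithinAt.mono_left hle
    exact h1.eventually (extChartAt_source_mem_nhds (I := 𝓡∂ 2) (F (0, 0)))
  obtain ⟨t, h1, h2, h3, h4, h5, ht⟩ := (ev1.and (ev2.and (ev3.and (ev4.and
    (ev5.and self_mem_nhdsWithin))))).exists
  refine ⟨(g (φ (H 0 t))).1, (g (φ (H 0 t))).2, ⟨h1, h2⟩, ?_⟩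
  have h6 : F (g (φ (H 0 t))) = H 0 t := φ.injOn h3 h5 h4
  rw [Prod.mk.eta, h6]
  exact hV 0 t ht

end IsAnnulus

end Annulus

/-! ### The sides of the cutting curves -/

theorem isClosed_range_of_periodic {X : Type} [TopologicalSpace X] [T2Space X] {c : ℝ → X}
    (hc : Continuous c) (hp : Function.Periodic c 1) : IsClosed (Set.range c) := by
  have : Set.range c = c '' Set.Icc 0 1 := by
    refine Set.Subset.antisymm ?_ (Set.image_subset_range _ _)
    rintro _ ⟨s, rfl⟩
    exact ⟨Int.fract s, ⟨Int.fract_nonneg _, (Int.fract_lt_one _).le⟩, hp.apply_fract s⟩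
  rw [this]
  exact (isCompact_Icc.image hc).isClosed

theorem range_reverseCurve {S : Type} (c : ℝ → S) : Set.range (reverseCurve c) = Set.range c :=
  neg_surjective.range_comp c

theorem reverseCurve_reverseCurve {S : Type} (c : ℝ → S) : reverseCurve (reverseCurve c) = c := by
  funext s
  simp [reverseCurve]

section Cutting

variable {S : Type} [TopologicalSpace S]

namespace IsCutting

variable {m l : ℕ} {ξ : Fin m → ℝ → S} {U : Fin l → Set S}

theorem eq_connectedComponentIn (hU : IsCutting ξ U) {x : S} {i : Fin l} (hx : x ∈ U i) :
    x ∈ (⋃ k, Set.range (ξ k))ᶜ ∧ U i = connectedComponentIn (⋃ k, Set.range (ξ k))ᶜ x := by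
  have h : U i ∈ Set.range U := ⟨i, rfl⟩
  rw [hU.range_eq] at h
  obtain ⟨y, -, hi⟩ := h
  rw [hi] at hx ⊢
  exact ⟨connectedComponentIn_subset _ _ hx, connectedComponentIn_eq hx⟩

theorem exists_mem (hU : IsCutting ξ U) {x : S} (hx : x ∈ (⋃ k, Set.range (ξ k))ᶜ) :
    ∃ i, x ∈ U i := by
  have h : connectedComponentIn (⋃ k, Set.range (ξ k))ᶜ x ∈ Set.range U := by
    rw [hU.range_eq]
    exact ⟨x, hx, rfl⟩
  obtain ⟨i, hi⟩ := h
  exact ⟨i, hi ▸ mem_connectedComponentIn hx⟩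

theorem eq_of_mem (hU : IsCutting ξ U) {x : S} {i j : Fin l} (hi : x ∈ U i) (hj : x ∈ U j) :
    i = j :=
  hU.injective ((hU.eq_connectedComponentIn hi).2.trans (hU.eq_connectedComponentIn hj).2.symm)

theorem subset_of_isPreconnected (hU : IsCutting ξ U) {T : Set S} (hT : IsPreconnected T)
    (hTO : T ⊆ (⋃ k, Set.range (ξ k))ᶜ) {x : S} {i : Fin l} (hxT : x ∈ T) (hx : x ∈ U i) :
    T ⊆ U i := by
  rw [(hU.eq_connectedComponentIn hx).2]
  exact hT.subset_connectedComponentIn hxT hTO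

variable [ChartedSpace (EuclideanHalfSpace 2) S]

/-- Curves disjoint from the cutting curves have at most one piece on their left. -/
theorem existsUnique_side_of_disjoint (hU : IsCutting ξ U)
    (hO : IsOpen (⋃ k, Set.range (ξ k))ᶜ) {c : ℝ → S} (hc : ∀ s, c s ∈ (⋃ k, Set.range (ξ k))ᶜ)
    {p : (Set.univ : Set S)} {γ : Pi1 Set.univ p} (h : IsPushOff Set.univ p c γ) :
    ∃ i, (∃ p' γ', IsPushOff (U i) p' c γ') ∧ ∀ i' p' γ', IsPushOff (U i') p' c γ' → i' = i := by
  obtain ⟨H, hH⟩ := h.exists_pushesInto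
  obtain ⟨ε, ⟨hε, hε1⟩, hsub⟩ := exists_homotopy_subset zero_lt_one hH.continuousOn hH.periodic hO
    (fun s => by rw [hH.start]; exact hc s)
  obtain ⟨i, hi⟩ := hU.exists_mem (hc 0)
  -- The short track of the homotopy, including the curve itself, is connected and misses the
  -- cutting curves.
  have hT : Function.uncurry H '' (Set.univ ×ˢ Set.Icc 0 ε) ⊆ U i := by
    refine hU.subset_of_isPreconnected ?_ ?_ ⟨(0, 0), ⟨trivial, le_rfl, hε.le⟩, hH.start 0⟩ hi
    · exact (isPreconnected_univ.prod isPreconnected_Icc).image _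
        (hH.continuousOn.mono (Set.prod_mono_right (Set.Icc_subset_Icc_right hε1.le)))
    · rintro _ ⟨⟨s, t⟩, ⟨-, ht⟩, rfl⟩
      exact hsub s t ht
  have hmem : ∀ s, ∀ t ∈ Set.Ioc 0 ε, H s t ∈ U i := fun s t ht =>
    hT ⟨(s, t), ⟨trivial, ht.1.le, ht.2⟩, rfl⟩
  refine ⟨i, ⟨⟨H 0 ε, hmem 0 ε ⟨hε, le_rfl⟩⟩, ?_⟩, fun i' p' γ' h' => ?_⟩
  · exact (hH.mono hε1.le hmem).exists_isPushOff hε hε1 ⟨H 0 ε, hmem 0 ε ⟨hε, le_rfl⟩⟩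
      (JoinedIn.refl (hmem 0 ε ⟨hε, le_rfl⟩))
  · obtain ⟨H', hH'⟩ := h'.exists_pushesInto
    have hH'0 : H' 0 1 ∈ U i' := hH'.mem 0 1 ⟨one_pos, le_rfl⟩
    -- Read backwards, the track of `c 0` joins a point of the piece `U i'` to `c 0` without meeting
    -- a cutting curve.
    have hc' : c 0 ∈ U i' := by
      refine hU.subset_of_isPreconnected (T := H' 0 '' Set.Icc 0 1) ?_ ?_
        ⟨1, ⟨zero_le_one, le_rfl⟩, rfl⟩ hH'0 ⟨0, ⟨le_rfl, zero_le_one⟩, hH'.start 0⟩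
      · refine isPreconnected_Icc.image _ ?_
        exact hH'.continuousOn.comp (f := fun t : ℝ => ((0 : ℝ), t)) (by fun_prop)
          fun t ht => ⟨trivial, ht⟩
      · rintro _ ⟨t, ht, rfl⟩
        rcases ht.1.eq_or_lt with rfl | ht0
        · rw [hH'.start]; exact hc 0
        · exact (hU.eq_connectedComponentIn (hH'.mem 0 t ⟨ht0, ht.2⟩)).1
    exact hU.eq_of_mem hc' hi

/-- There is exactly one piece on the left of a cutting curve. -/
theorem existsUnique_side_of_annulus [T2Space S] (hU : IsCutting ξ U) (hξ : IsCurveSystem ξ)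
    {k : Fin m} {c : ℝ → S} {F : ℝ × ℝ → S} (hF : IsAnnulus F c)
    (hc : Set.range c = Set.range (ξ k)) :
    ∃ i, (∃ p' γ', IsPushOff (U i) p' c γ') ∧ ∀ i' p' γ', IsPushOff (U i') p' c γ' → i' = i := by
  have hcl : IsClosed (⋃ j ∈ {j | j ≠ k}, Set.range (ξ j)) :=
    (Set.toFinite _).isClosed_biUnion fun j _ =>
      isClosed_range_of_periodic (hξ.simple j).smooth.continuous (hξ.simple j).periodic
  obtain ⟨ε, ⟨hε, hε1⟩, hsub⟩ := exists_homotopy_subset (H := fun s t => F (s, t))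
    (δ := 1 / 2) (by norm_num)
    (hF.smooth.continuousOn.mono (Set.prod_mono_right fun t ht =>
      ⟨by linarith [ht.1], by linarith [ht.2]⟩))
    (fun s t _ => hF.periodic s t) hcl.isOpen_compl (fun s => by
      simp only [Set.mem_compl_iff, Set.mem_iUnion, not_exists]
      intro j hj hs
      refine Set.disjoint_left.1 (hξ.disjoint hj) hs ?_
      rw [hF.core, ← hc]
      exact ⟨s, rfl⟩)
  have hp : ∀ s t, F (Int.fract s, t) = F (s, t) := fun s t =>
    Function.Periodic.apply_fract (f := fun s => F (s, t)) (fun s => hF.periodic s t) s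
  have hO : ∀ s, ∀ t ∈ Set.Ioc 0 ε, F (s, t) ∈ (⋃ k, Set.range (ξ k))ᶜ := by
    intro s t ht hmem
    obtain ⟨j, hj⟩ := Set.mem_iUnion.1 hmem
    -- A thin half annulus misses its own core by injectivity and the other curves because these
    -- form a closed set disjoint from the core.
    by_cases hjk : j = k
    · rw [hjk, ← hc] at hj
      obtain ⟨s', hs'⟩ := hj
      rw [← hF.core, ← hp s', ← hp s] at hs'
      have h1 := hF.injOn (x₁ := (Int.fract s', 0)) (x₂ := (Int.fract s, t))
        ⟨⟨Int.fract_nonneg _, Int.fract_lt_one _⟩, by simp⟩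
        ⟨⟨Int.fract_nonneg _, Int.fract_lt_one _⟩, by simp only; linarith [ht.1],
          by simp only; linarith [ht.2]⟩ hs'
      exact ht.1.ne (congrArg Prod.snd h1)
    · exact hsub s t ⟨ht.1.le, ht.2⟩ (Set.mem_biUnion hjk hj)
  obtain ⟨i, hi⟩ := hU.exists_mem (hO 0 ε ⟨hε, le_rfl⟩)
  have hT : F '' (Set.univ ×ˢ Set.Ioc 0 ε) ⊆ U i := by
    refine hU.subset_of_isPreconnected ?_ ?_ ⟨(0, ε), ⟨trivial, hε, le_rfl⟩, rfl⟩ hi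
    · exact (isPreconnected_univ.prod isPreconnected_Ioc).image _
        (hF.smooth.continuousOn.mono (Set.prod_mono_right fun t ht =>
          ⟨by linarith [ht.1], by linarith [ht.2]⟩))
    · rintro _ ⟨⟨s, t⟩, ⟨-, ht⟩, rfl⟩
      exact hO s t ht
  have hmem : ∀ s, ∀ t ∈ Set.Ioc 0 ε, F (s, t) ∈ U i := fun s t ht =>
    hT ⟨(s, t), ⟨trivial, ht⟩, rfl⟩
  refine ⟨i, ⟨⟨F (0, ε), hi⟩, ?_⟩, fun i' p' γ' h' => ?_⟩
  · exact (hF.pushesInto (by linarith) hmem).exists_isPushOff hε (by linarith) ⟨F (0, ε), hi⟩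
      (JoinedIn.refl hi)
  -- Any left push-off enters this half annulus, so the piece it lies in must be `U i`.
  · obtain ⟨s, t, ht, hst⟩ := hF.exists_mem_of_isPushOff h' hε
    exact hU.eq_of_mem hst (hmem s t ⟨ht.1, ht.2.le⟩)

end IsCutting

variable [ChartedSpace (EuclideanHalfSpace 2) S]

/-- The first half of the push is kept, because moving to the new base point `p'` needs some time
left over. -/
theorem IsPushOff.exists_univ [PathConnectedSpace S] {V : Set S} {p : V} {c : ℝ → S}
    {γ : Pi1 V p} (h : IsPushOff V p c γ) (p' : (Set.univ : Set S)) :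
    ∃ γ', IsPushOff Set.univ p' c γ' := by
  obtain ⟨H, hH⟩ := h.exists_pushesInto
  refine (hH.mono (W := Set.univ) (δ := 1 / 2) (by norm_num) fun _ _ _ =>
    trivial).exists_isPushOff (by norm_num) (by norm_num) p' ?_
  rw [joinedIn_univ]
  exact PathConnectedSpace.joined _ _

end Cutting

/-! ### Restriction of cocycles -/

section Cocycles

variable {n : ℕ} {Γ : Type} [Group Γ] {ρ : Γ →* PSL(n, ℝ)}

theorem isAdCocycle_cocycles₁ (a : groupCohomology.cocycles₁ (adModule ρ)) : IsAdCocycle ρ a :=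
  (groupCohomology.mem_cocycles₁_iff _).1 a.2

/-- For a fixed `X` the elements on which the cocycle is the coboundary of `X` form a subgroup, so a
condition on the generator is enough. -/
theorem IsLocalPotential.of_mem_zpowers {α : Γ → LieAlgebra.SpecialLinear.sl (Fin n) ℝ}
    (hα : IsAdCocycle ρ α) {γ : Γ} {X : LieAlgebra.SpecialLinear.sl (Fin n) ℝ}
    (h : IsLocalPotential ρ α γ X) {δ : Γ} (hδ : δ ∈ Subgroup.zpowers γ) :
    IsLocalPotential ρ α δ X := by
  let N : Subgroup Γ :=
    { carrier := {δ | IsLocalPotential ρ α δ X}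
      one_mem' := by
        simp only [Set.mem_ofPred_eq, IsLocalPotential, hα.map_one, map_one ρ, adRep_one_apply,
          sub_self]
      mul_mem' := fun {u w} hu hw => by
        simp only [Set.mem_ofPred_eq, IsLocalPotential] at hu hw ⊢
        rw [hα, hu, hw, map_mul ρ, adRep_mul_apply, map_sub]
        abel
      inv_mem' := fun hu => IsLocalPotential.inv hα hu }
  exact (Subgroup.zpowers_le (H := N)).2 h hδ

theorem mk_mem_H1par_of_isLocalPotential (a : groupCohomology.cocycles₁ (adModule ρ)) {T : Set Γ}
    (h : ∀ γ ∈ T, ∃ X, IsLocalPotential ρ a γ X) :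
    groupCohomology.H1π (adModule ρ) a ∈ H1par ρ T :=
  (mk_mem_H1par_iff ρ T a).2 fun γ hγ => (h γ hγ).imp fun _ hX _ hδ =>
    hX.of_mem_zpowers (isAdCocycle_cocycles₁ a) hδ

theorem resH1_mk {Λ : Type} [Group Λ] (ι : Λ →* Γ) (a : groupCohomology.cocycles₁ (adModule ρ)) :
    ∃ a' : groupCohomology.cocycles₁ (adModule (ρ.comp ι)), (∀ δ, a' δ = a (ι δ)) ∧
      resH1 ρ ι (groupCohomology.H1π (adModule ρ) a) =
        groupCohomology.H1π (adModule (ρ.comp ι)) a' := by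
  let φ : Rep.res ι (adModule ρ) ⟶ adModule (ρ.comp ι) := CategoryTheory.CategoryStruct.id _
  exact ⟨groupCohomology.mapCocycles₁ ι φ a, fun _ => rfl,
    groupCohomology.H1π_comp_map_apply ι φ a⟩

end Cocycles

/-! ### The pairing in terms of boundary values of a primitive -/

/-- The new generator stands at the end of the longer relator. Once that relator is trivial, the old
one equals the inverse of the loop around the puncture. -/
theorem lift_addBoundary_surfaceRelator {Γ : Type} [Group Γ] {g b : ℕ} (v : Gen g b → Γ) (w : Γ) :
    FreeGroup.lift (addBoundary v w) (surfaceRelator g (b + 1)) =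
      FreeGroup.lift v (surfaceRelator g b) * w := by
  simp only [surfaceRelator, map_mul, map_list_prod, List.map_ofFn, List.ofFn_succ',
    List.concat_eq_append, List.prod_append, List.prod_singleton, ← mul_assoc]
  have h1 : (fun i : Fin g => FreeGroup.lift (addBoundary v w)
      (FreeGroup.of (Gen.x i) * FreeGroup.of (Gen.y i) * (FreeGroup.of (Gen.x i))⁻¹ *
        (FreeGroup.of (Gen.y i))⁻¹)) = fun i : Fin g => FreeGroup.lift v
      (FreeGroup.of (Gen.x i) * FreeGroup.of (Gen.y i) * (FreeGroup.of (Gen.x i))⁻¹ *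
        (FreeGroup.of (Gen.y i))⁻¹) := by
    funext i
    simp [addBoundary]
  have h2 : (fun j : Fin b => FreeGroup.lift (addBoundary v w)
      (FreeGroup.of (Gen.z j.castSucc))) = fun j : Fin b =>
        FreeGroup.lift v (FreeGroup.of (Gen.z j)) := by
    funext j
    simp [addBoundary]
  have h3 : FreeGroup.lift (addBoundary v w) (FreeGroup.of (Gen.z (Fin.last b))) = w := by
    simp [addBoundary]
  simp only [Function.comp_def]
  rw [h1, h2, h3]

/-- Here `Γ` is to be the punctured group and `v'` a lift of the generators `v`. A primitive is
needed only on `Γ`, where the relator may be nontrivial; this accounts for the last term. -/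
theorem omegaK_eq_sum {n g b : ℕ} {Λ Γ : Type} [Group Λ] [Group Γ] (ρ : Λ →* PSL(n, ℝ))
    {v : Gen g b → Λ} (hv : FreeGroup.lift v (surfaceRelator g b) = 1)
    (A C : H1par ρ (Set.range fun j => v (Gen.z j)))
    (a c : groupCohomology.cocycles₁ (adModule ρ))
    (hA : groupCohomology.H1π (adModule ρ) a = A.1)
    (hC : groupCohomology.H1π (adModule ρ) c = C.1)
    {ρ' : Γ →* PSL(n, ℝ)} {α β : Γ → LieAlgebra.SpecialLinear.sl (Fin n) ℝ}
    (hα : IsAdCocycle ρ' α) (hβ : IsAdCocycle ρ' β) {f : Γ → ℝ} (hf : IsCupPrimitive α β f)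
    {v' : Gen g b → Γ} (hρ : ∀ s, ρ (v s) = ρ' (v' s))
    (ha : ∀ w, a (FreeGroup.lift v w) = α (FreeGroup.lift v' w))
    (hc : ∀ w, c (FreeGroup.lift v w) = β (FreeGroup.lift v' w))
    (X : Fin b → LieAlgebra.SpecialLinear.sl (Fin n) ℝ)
    (hX : ∀ j, IsLocalPotential ρ' α (v' (Gen.z j)) (X j)) :
    omegaK v ρ A C = ∑ j, (f (v' (Gen.z j)) - trForm n (X j) (β (v' (Gen.z j)))) -
      f (FreeGroup.lift v' (surfaceRelator g b)) := by
  have ha' : ∀ s, a (v s) = α (v' s) := fun s => by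
    simpa only [FreeGroup.lift_apply_of] using ha (FreeGroup.of s)
  have hc' : ∀ s, c (v s) = β (v' s) := fun s => by
    simpa only [FreeGroup.lift_apply_of] using hc (FreeGroup.of s)
  rw [omegaK_eq v ρ hv A C a c hA hC X fun j => by rw [ha', hρ]; exact hX j,
    cupPairing_congr ha hc, hf.cupPairing_eq hα hβ, Finset.sum_sub_distrib]
  simp only [hc']
  ring

section BoundaryValue

variable {n : ℕ} {Γ : Type} [Group Γ] {ρ : Γ →* PSL(n, ℝ)}
  {α β : Γ → LieAlgebra.SpecialLinear.sl (Fin n) ℝ} {f : Γ → ℝ}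

/-- With `Represents.exists_conj` this makes the boundary value an invariant of the closed curve,
whatever representative and potential are chosen. -/
theorem IsCupPrimitive.conj_eq (hα : IsAdCocycle ρ α) (hβ : IsAdCocycle ρ β)
    (hf : IsCupPrimitive α β f) {γ γ' g : Γ} (hg : γ' = g * γ * g⁻¹)
    {X X' Y : LieAlgebra.SpecialLinear.sl (Fin n) ℝ} (hX : IsLocalPotential ρ α γ X)
    (hX' : IsLocalPotential ρ α γ' X') (hY : IsLocalPotential ρ β γ' Y) :
    f γ' - trForm n X' (β γ') = f γ - trForm n X (β γ) := by
  subst hg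
  rw [← hf.conj_sub hα hβ hX g, hX'.trForm_eq (hX.conj hα g) hY]

end BoundaryValue

/-! ### Lifting the pieces to a punctured surface -/

section Puncture

variable {S : Type} [TopologicalSpace S]

theorem Pi1.inclPath_incl {U V W : Set S} (h : U ⊆ V) (h' : V ⊆ W) {p : U} {q : W}
    (η : Path (Set.inclusion h' (Set.inclusion h p)) q) (γ : Pi1 U p) :
    Pi1.inclPath h' η (Pi1.incl h p γ) = Pi1.inclPath (h.trans h') (p := p) η γ := by
  obtain ⟨u, rfl⟩ := Pi1.mk_surjective γ
  rfl

/-- The homomorphism from the group of the punctured surface to the group of the surface. -/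
noncomputable def punctureIncl (q : S) (p : (Set.univ : Set S)) (hp : (p : S) ≠ q) :
    Pi1 (Set.univ \ {q} : Set S) ⟨p, p.2, hp⟩ →* Pi1 Set.univ p :=
  Pi1.incl (V := Set.univ \ {q}) (W := Set.univ) Set.sdiff_subset ⟨(p : S), p.2, hp⟩

variable [ChartedSpace (EuclideanHalfSpace 2) S]

theorem smallCircle_ne {q : S} {r : ℝ} (hr : 0 < r)
    (hb : Metric.closedBall (extChartAt (𝓡∂ 2) q q) r ⊆ (extChartAt (𝓡∂ 2) q).target) (s : ℝ) :
    smallCircle q r s ≠ q := by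
  let ν : EuclideanSpace ℝ (Fin 2) :=
    !₂[Real.cos (2 * Real.pi * s), -Real.sin (2 * Real.pi * s)]
  have hν : ‖ν‖ = 1 := by
    simp [ν, EuclideanSpace.norm_eq, Fin.sum_univ_two, Real.cos_sq_add_sin_sq]
  have hd : dist (extChartAt (𝓡∂ 2) q q + r • ν) (extChartAt (𝓡∂ 2) q q) = r := by
    rw [dist_eq_norm, add_sub_cancel_left, norm_smul, hν, mul_one, Real.norm_eq_abs, abs_of_pos hr]
  intro h
  have h1 := congrArg (extChartAt (𝓡∂ 2) q) h
  have h2 : extChartAt (𝓡∂ 2) q (smallCircle q r s) = extChartAt (𝓡∂ 2) q q + r • ν :=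
    (extChartAt (𝓡∂ 2) q).right_inv (hb (Metric.mem_closedBall.2 hd.le))
  rw [← h2, h1, dist_self] at hd
  exact hr.ne hd

/-- Positivity of the presentation lifts every generator across the puncture. -/
theorem punctureIncl_surjective {p : (Set.univ : Set S)} {K : Type} {c : K → ℝ → S}
    (σ : StandardSystem Set.univ p c) {q : S} (hq : q ∈ (𝓡∂ 2).interior S) (hp : (p : S) ≠ q) :
    Function.Surjective (punctureIncl q p hp) := by
  obtain ⟨gen', w, hgen, -⟩ := σ.positive q trivial hq hp
  have h : (punctureIncl q p hp).comp (FreeGroup.lift gen') = FreeGroup.lift σ.gen := by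
    ext s
    simp only [MonoidHom.comp_apply, FreeGroup.lift_apply_of]
    exact hgen s
  intro γ
  obtain ⟨u, hu⟩ := σ.presents.1 γ
  exact ⟨FreeGroup.lift gen' u, by rw [← hu, ← h]; rfl⟩

/-- The generators of a piece, carried into the group of `S` along `η`, lift to the punctured group
with the right peripheral classes. A piece that misses `x` already lies in the punctured surface, so
its relation persists; for a piece that contains `x`, positivity of its presentation turns the
relator into the inverse of the loop around `x`. -/
theorem StandardSystem.exists_lift {V : Set S} {q : V} {K : Type} {c : K → ℝ → S}
    (τ : StandardSystem V q c) {x : S} (hx : x ∈ (𝓡∂ 2).interior S) (hqx : (q : S) ≠ x)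
    {p : (Set.univ : Set S)} (hpx : (p : S) ≠ x)
    (hW : IsPathConnected (Set.univ \ {x} : Set S))
    (hsurj : Function.Surjective (punctureIncl x p hpx))
    (η : Path (Set.inclusion (Set.subset_univ V) q) p) (hc : ∀ j s, c (τ.e j) s ≠ x) :
    ∃ v' : Gen τ.g τ.b → Pi1 (Set.univ \ {x} : Set S) ⟨p, p.2, hpx⟩,
      (∀ s, punctureIncl x p hpx (v' s) = Pi1.inclPath (Set.subset_univ V) η (τ.gen s)) ∧
      (∀ j, Represents (Set.univ \ {x}) ⟨p, p.2, hpx⟩ (c (τ.e j)) (v' (Gen.z j))) ∧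
      (x ∉ V → FreeGroup.lift v' (surfaceRelator τ.g τ.b) = 1) ∧
      (x ∈ V → ∃ r > 0,
        Metric.closedBall (extChartAt (𝓡∂ 2) x x) r ⊆ (extChartAt (𝓡∂ 2) x).target ∧
        Represents (Set.univ \ {x}) ⟨p, p.2, hpx⟩ (smallCircle x r)
          (FreeGroup.lift v' (surfaceRelator τ.g τ.b))⁻¹) := by
  have hj : JoinedIn (Set.univ \ {x} : Set S) q p := hW.joinedIn _ ⟨trivial, hqx⟩ _ ⟨p.2, hpx⟩
  by_cases hxV : x ∈ V
  · obtain ⟨gen', w, hgen, hper, ⟨r, hr, hball, -, hw⟩, hpres⟩ := τ.positive x hxV hx hqx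
    have hVW : V \ {x} ⊆ Set.univ \ {x} := Set.sdiff_subset_sdiff_left (Set.subset_univ V)
    obtain ⟨lam, hlam⟩ := Pi1.exists_inclPath_eq hVW (q := ⟨q, q.2, hqx⟩) (p := ⟨p, p.2, hpx⟩)
      hj hsurj η
    have hη : ∀ γ : Pi1 (V \ {x}) ⟨q, q.2, hqx⟩, Pi1.inclPath (Set.subset_univ V) η
        (Pi1.incl (W := V) Set.sdiff_subset ⟨q, q.2, hqx⟩ γ) =
          Pi1.inclPath (p := ⟨q, q.2, hqx⟩) (Set.subset_univ (V \ {x})) (q := p) η γ := fun γ =>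
      Pi1.inclPath_incl (U := V \ {x}) (V := V) (W := Set.univ) (p := ⟨q, q.2, hqx⟩) (q := p)
        Set.sdiff_subset (Set.subset_univ V) η γ
    have hlift : FreeGroup.lift (fun s => Pi1.inclPath hVW lam (gen' s))
        (surfaceRelator τ.g τ.b) = Pi1.inclPath hVW lam w⁻¹ := by
      have h1 := hpres.lift_relator
      rw [lift_addBoundary_surfaceRelator] at h1
      rw [← eq_inv_of_mul_eq_one_left h1, ← MonoidHom.comp_apply]
      congr 1
      ext s
      simp
    refine ⟨fun s => Pi1.inclPath hVW lam (gen' s), fun s => ?_, fun j => ?_,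
      fun h => absurd hxV h, fun _ => ⟨r, hr, hball, ?_⟩⟩
    · rw [← hgen]
      exact (hlam (gen' s)).trans (hη (gen' s)).symm
    · exact Represents.inclPath hVW lam ((hper j).represents hVW fun s => ⟨trivial, hc j s⟩)
    · rw [hlift, map_inv, inv_inv]
      refine Represents.inclPath hVW lam (hw.represents hVW fun s =>
        ⟨trivial, smallCircle_ne hr hball s⟩)
  · have hVW : V ⊆ Set.univ \ {x} := fun y hy => ⟨trivial, fun h => hxV (h ▸ hy)⟩
    obtain ⟨lam, hlam⟩ := Pi1.exists_inclPath_eq hVW (p := ⟨p, p.2, hpx⟩) hj hsurj η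
    have hlift : FreeGroup.lift (fun s => Pi1.inclPath hVW lam (τ.gen s))
        (surfaceRelator τ.g τ.b) = 1 := by
      rw [← map_one (Pi1.inclPath hVW lam), ← τ.presents.lift_relator, ← MonoidHom.comp_apply]
      congr 1
      ext s
      simp
    exact ⟨fun s => Pi1.inclPath hVW lam (τ.gen s), fun s => hlam _,
      fun j => Represents.inclPath hVW lam
        ((τ.peripheral j).represents hVW fun s => ⟨trivial, hc j s⟩), fun _ => hlift,
      fun h => absurd h hxV⟩

end Puncture

/-! ### Matching the boundary curves of the pieces -/

theorem sum_comp_eq_of_range_eq {A B K : Type} [Fintype A] [Fintype B] {d : A → K} {e : B → K}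
    (hd : Function.Injective d) (he : Function.Injective e) (h : Set.range d = Set.range e)
    (φ : K → ℝ) : ∑ x, φ (d x) = ∑ y, φ (e y) := by
  classical
  rw [← Finset.sum_image (f := φ) (g := d) (s := Finset.univ) hd.injOn,
    ← Finset.sum_image (f := φ) (g := e) (s := Finset.univ) he.injOn]
  congr 1
  rw [← Finset.coe_inj]
  simpa using h

section Matching

variable {S : Type} [TopologicalSpace S] [ChartedSpace (EuclideanHalfSpace 2) S]
  {b m l : ℕ} {ζ : Fin b → ℝ → S} {ξ : Fin m → ℝ → S} {U : Fin l → Set S}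

theorem IsCurveSystem.isOpen_compl [T2Space S] (hξ : IsCurveSystem ξ) :
    IsOpen (⋃ k, Set.range (ξ k))ᶜ :=
  (isClosed_iUnion_of_finite fun k => isClosed_range_of_periodic
    (hξ.simple k).smooth.continuous (hξ.simple k).periodic).isOpen_compl

theorem IsBoundary.mem_compl (hζ : IsBoundary ζ) (hξ : IsCurveSystem ξ) (j : Fin b) (s : ℝ) :
    ζ j s ∈ (⋃ k, Set.range (ξ k))ᶜ := by
  intro hmem
  obtain ⟨k, t, ht⟩ := Set.mem_iUnion.1 hmem
  have h1 : ζ j s ∈ (𝓡∂ 2).boundary S := by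
    rw [← hζ.cover]
    exact Set.mem_iUnion.2 ⟨j, s, rfl⟩
  have h2 : ζ j s ∈ (𝓡∂ 2).interior S := ht ▸ hξ.interior k t
  exact Set.disjoint_left.1 (𝓡∂ 2).disjoint_interior_boundary h2 h1

/-- Every boundary curve and each side of every cutting curve belongs to exactly one piece. -/
theorem existsUnique_side [T2Space S] (hζ : IsBoundary ζ) (hξ : IsCurveSystem ξ) (hU : IsCutting ξ U)
    {p : (Set.univ : Set S)} (σ : StandardSystem Set.univ p ζ)
    (x : Fin σ.b ⊕ Fin m ⊕ Fin m) :
    ∃ i, (∃ p' γ', IsPushOff (U i) p' (cutCurves ζ ξ (Sum.map σ.e id x)) γ') ∧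
      ∀ i' p' γ', IsPushOff (U i') p' (cutCurves ζ ξ (Sum.map σ.e id x)) γ' → i' = i := by
  rcases x with j | k | k
  · exact hU.existsUnique_side_of_disjoint hξ.isOpen_compl (hζ.mem_compl hξ (σ.e j))
      (σ.peripheral j)
  · obtain ⟨F, hF⟩ := hξ.annulus k
    exact hU.existsUnique_side_of_annulus hξ hF rfl
  · obtain ⟨F, hF⟩ := hξ.annulus k
    exact hU.existsUnique_side_of_annulus hξ hF.reverse (range_reverseCurve _)

/-- If a curve `ζ k` bounds a piece, it also has a push-off in `S`, so completeness of `σ` lists it.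
Hence the numbering of `σ` may index the boundary curves. -/
theorem e_mem_range [PathConnectedSpace S] {p : (Set.univ : Set S)}
    (σ : StandardSystem Set.univ p ζ) {V : Set S} {q : V}
    (τ : StandardSystem V q (cutCurves ζ ξ)) (j : Fin τ.b) :
    τ.e j ∈ Set.range (Sum.map σ.e (id : Fin m ⊕ Fin m → Fin m ⊕ Fin m)) := by
  have h1 := τ.peripheral j
  rcases h2 : τ.e j with k | k
  · rw [h2] at h1
    obtain ⟨γ', h3⟩ := h1.exists_univ p
    obtain ⟨j', hj'⟩ := σ.complete k p γ' h3
    exact ⟨Sum.inl j', by simp [hj']⟩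
  · exact ⟨Sum.inr k, by simp⟩

/-- The boundary curves of the pieces are the boundary curves of the surface and the two sides of
every cutting curve. -/
theorem sum_boundary_pieces [T2Space S] [PathConnectedSpace S] (hζ : IsBoundary ζ) (hξ : IsCurveSystem ξ)
    (hU : IsCutting ξ U) {p : (Set.univ : Set S)} (σ : StandardSystem Set.univ p ζ)
    {q : ∀ i, U i} (τ : ∀ i, StandardSystem (U i) (q i) (cutCurves ζ ξ))
    (φ : Fin b ⊕ Fin m ⊕ Fin m → ℝ) :
    ∑ i, ∑ j, φ ((τ i).e j) = ∑ j, φ (Sum.inl (σ.e j)) +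
      ∑ k, (φ (Sum.inr (Sum.inl k)) + φ (Sum.inr (Sum.inr k))) := by
  have hside := existsUnique_side hζ hξ hU σ
  let E : (Σ i, Fin (τ i).b) → Fin b ⊕ Fin m ⊕ Fin m := fun x => (τ x.1).e x.2
  let D : Fin σ.b ⊕ Fin m ⊕ Fin m → Fin b ⊕ Fin m ⊕ Fin m := Sum.map σ.e id
  have hD : Function.Injective D := σ.e_injective.sumMap Function.injective_id
  have hED : ∀ x, E x ∈ Set.range D := fun x => e_mem_range σ (τ x.1) x.2
  -- Uniqueness of the side prevents two pieces from listing the same oriented curve.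
  have hE : Function.Injective E := by
    rintro ⟨i, j⟩ ⟨i', j'⟩ h
    obtain ⟨x, hx⟩ := hED ⟨i, j⟩
    obtain ⟨i₀, -, hi₀⟩ := hside x
    have h1 : i = i₀ := hi₀ i (q i) ((τ i).gen (Gen.z j)) (by
      change IsPushOff _ _ (cutCurves ζ ξ (D x)) _
      rw [hx]
      exact (τ i).peripheral j)
    have h2 : i' = i₀ := hi₀ i' (q i') ((τ i').gen (Gen.z j')) (by
      change IsPushOff _ _ (cutCurves ζ ξ (D x)) _
      rw [hx, h]
      exact (τ i').peripheral j')
    subst h1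
    subst h2
    have hj : j = j' := (τ i').e_injective h
    rw [hj]
  -- Every side lies in some piece, and completeness of that piece's presentation lists it.
  have hrange : Set.range E = Set.range D := by
    refine Set.Subset.antisymm (Set.range_subset_iff.2 hED) (Set.range_subset_iff.2 fun x => ?_)
    obtain ⟨i, ⟨p', γ', h⟩, -⟩ := hside x
    obtain ⟨j, hj⟩ := (τ i).complete _ p' γ' h
    exact ⟨⟨i, j⟩, hj⟩
  have h := sum_comp_eq_of_range_eq hE hD hrange φ
  rw [Fintype.sum_sigma, Fintype.sum_sum_type, Fintype.sum_sum_type, ← Finset.sum_add_distrib] at h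
  exact h

end Matching

/-! ### Comparison of the pairings through the punctured surface -/

section Main

variable {S : Type} [TopologicalSpace S] [T2Space S] [ChartedSpace (EuclideanHalfSpace 2) S]
  {b m l : ℕ} {ζ : Fin b → ℝ → S} {ξ : Fin m → ℝ → S} {U : Fin l → Set S}

/-- If there is a cutting curve, the piece on its left provides a point off all cutting curves. -/
theorem IsCutting.nonempty_compl [Nonempty S] (hU : IsCutting ξ U) (hξ : IsCurveSystem ξ) :
    (⋃ k, Set.range (ξ k))ᶜ.Nonempty := by
  rcases isEmpty_or_nonempty (Fin m) with h | ⟨⟨k⟩⟩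
  · simp
  · obtain ⟨F, hF⟩ := hξ.annulus k
    obtain ⟨i, ⟨p, -⟩, -⟩ := hU.existsUnique_side_of_annulus hξ hF rfl
    exact ⟨p, (hU.eq_connectedComponentIn p.2).1⟩

/-- A class that is parabolic along the curves `ζ j` and `ξ k` is locally a coboundary along every
boundary curve of a piece. -/
theorem exists_isLocalPotential [PathConnectedSpace S] (hζ : IsBoundary ζ)
    (hξ : IsCurveSystem ξ) (hU : IsCutting ξ U)
    {p : (Set.univ : Set S)} (σ : StandardSystem Set.univ p ζ) {n : ℕ}
    {ρ : Pi1 Set.univ p →* PSL(n, ℝ)} (a : groupCohomology.cocycles₁ (adModule ρ))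
    (ha : groupCohomology.H1π (adModule ρ) a ∈ H1par ρ (curveClasses p (Sum.elim ζ ξ)))
    (x : Fin σ.b ⊕ Fin m ⊕ Fin m) {γ : Pi1 Set.univ p}
    (hγ : Represents Set.univ p (cutCurves ζ ξ (Sum.map σ.e id x)) γ) :
    ∃ X, IsLocalPotential ρ a γ X := by
  have hcoc := isAdCocycle_cocycles₁ a
  -- Parabolicity is given on push-offs only; other representatives of the same curve are conjugate
  -- to them.
  have key : ∀ {k δ γ}, IsPushOff Set.univ p (Sum.elim ζ ξ k) δ →
      Represents Set.univ p (Sum.elim ζ ξ k) γ → ∃ X, IsLocalPotential ρ a γ X := by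
    intro k δ γ hδ hγ
    obtain ⟨X, hX⟩ := (mk_mem_H1par_iff ρ _ a).1 ha δ ⟨k, hδ⟩
    obtain ⟨g, rfl⟩ := hδ.represents_self.exists_conj hγ
    exact ⟨_, IsLocalPotential.conj hcoc (hX δ (Subgroup.mem_zpowers δ)) g⟩
  have hξδ : ∀ k, ∃ δ, IsPushOff Set.univ p (ξ k) δ := fun k => by
    obtain ⟨i, ⟨p', γ', h⟩, -⟩ := existsUnique_side hζ hξ hU σ (Sum.inr (Sum.inl k))
    exact h.exists_univ p
  rcases x with j | k | k
  · exact key (k := Sum.inl (σ.e j)) (σ.peripheral j) hγ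
  · obtain ⟨δ, hδ⟩ := hξδ k
    exact key (k := Sum.inr k) hδ hγ
  · obtain ⟨δ, hδ⟩ := hξδ k
    have hper : ∀ s, reverseCurve (ξ k) (s + 1) = reverseCurve (ξ k) s := fun s => by
      rw [reverseCurve, reverseCurve, ← (hξ.simple k).periodic]
      congr 1
      ring
    -- The reversed curve is not among the given parabolic curves; its representatives are inverses
    -- of those of `ξ k`, with the same potential.
    have h1 : Represents Set.univ p (ξ k) γ⁻¹ := by
      have := Represents.reverse (c := reverseCurve (ξ k)) hper hγ
      rwa [reverseCurve_reverseCurve] at this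
    obtain ⟨X, hX⟩ := key (k := Sum.inr k) hδ h1
    have := hX.inv hcoc
    rw [inv_inv] at this
    exact ⟨X, this⟩

end Main

theorem corollary4p6 (n : ℕ) (S : Type) [TopologicalSpace S] [T2Space S] [CompactSpace S]
    [ConnectedSpace S] [ChartedSpace (EuclideanHalfSpace 2) S] [IsManifold (𝓡∂ 2) ∞ S]
    [OrientedAtlas S]
    {b m l : ℕ} (ζ : Fin b → ℝ → S) (hζ : IsBoundary ζ)
    (ξ : Fin m → ℝ → S) (hξ : IsCurveSystem ξ)
    (U : Fin l → Set S) (hU : IsCutting ξ U)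
    -- standard presentations of the fundamental groups of `S` and of the pieces
    (p : (Set.univ : Set S)) (σ : StandardSystem Set.univ p ζ)
    (q : ∀ i, U i) (τ : ∀ i, StandardSystem (U i) (q i) (cutCurves ζ ξ))
    -- the homomorphisms from the groups of the pieces to the group of `S`
    (η : ∀ i, Path (Set.inclusion (Set.subset_univ (U i)) (q i)) p)
    (ι : ∀ i, Pi1 (U i) (q i) →* Pi1 Set.univ p)
    (hι : ∀ i, ι i = Pi1.inclPath (Set.subset_univ (U i)) (η i))
    -- the representation, with prescribed conjugacy classes along `ζ` and `ξ`
    (ρ : Pi1 Set.univ p →* PSL(n, ℝ)) (hρ : IsGoodRep ρ)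
    (B : Fin b → ConjClasses PSL(n, ℝ)) (C : Fin m → ConjClasses PSL(n, ℝ))
    (hB : ∀ j γ, IsPushOff Set.univ p (ζ j) γ → ConjClasses.mk (ρ γ) = B j)
    (hC : ∀ k γ, IsPushOff Set.univ p (ξ k) γ → ConjClasses.mk (ρ γ) = C k)
    (hρU : ∀ i, IsGoodRep (ρ.comp (ι i)))
    (α β : H1par ρ (curveClasses p (Sum.elim ζ ξ))) :
    ∃ (hα : ∀ i, resH1 ρ (ι i) α ∈
        H1par (ρ.comp (ι i)) (Set.range fun j => (τ i).gen (Gen.z j)))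
      (hβ : ∀ i, resH1 ρ (ι i) β ∈
        H1par (ρ.comp (ι i)) (Set.range fun j => (τ i).gen (Gen.z j))),
      omegaK σ.gen ρ ⟨α, H1par_anti ρ (σ.range_subset ξ) α.2⟩
          ⟨β, H1par_anti ρ (σ.range_subset ξ) β.2⟩ =
        ∑ i, omegaK (τ i).gen (ρ.comp (ι i)) ⟨resH1 ρ (ι i) α, hα i⟩
          ⟨resH1 ρ (ι i) β, hβ i⟩ := by
  have hlpc := ChartedSpace.locallyPathConnectedSpace (EuclideanHalfSpace 2) S
  have hpc : PathConnectedSpace S := PathConnectedSpace.of_locallyPathConnectedSpace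
  -- a puncture `x` in the piece `U i₀`
  obtain ⟨x, hxO, hxint, hxs⟩ := exists_interior_notMem_finite hξ.isOpen_compl
    (hU.nonempty_compl hξ)
    ((Set.finite_singleton (p : S)).union (Set.finite_range fun i => (q i : S)))
  rw [Set.mem_union, not_or] at hxs
  have hpx : (p : S) ≠ x := fun h => hxs.1 h.symm
  have hqx : ∀ i, (q i : S) ≠ x := fun i h => hxs.2 ⟨i, h⟩
  obtain ⟨i₀, hi₀⟩ := hU.exists_mem hxO
  obtain ⟨gen', w, hgen', hper', ⟨r, hr, hball, -, hw⟩, hpres⟩ := σ.positive x trivial hxint hpx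
  have hW : IsPathConnected (Set.univ \ {x} : Set S) := isPathConnected_compl_point x hr hball hpx
  have hsurj := punctureIncl_surjective σ hxint hpx
  let κ := punctureIncl x p hpx
  -- the curves avoid the puncture
  have hboundary : ∀ j s, ζ j s ≠ x := fun j s h => by
    have h1 : x ∈ (𝓡∂ 2).boundary S := by
      rw [← hζ.cover, ← h]
      exact Set.mem_iUnion.2 ⟨j, s, rfl⟩
    exact Set.disjoint_left.1 (𝓡∂ 2).disjoint_interior_boundary hxint h1
  have hξx : ∀ k s, ξ k s ≠ x := fun k s h => hxO (h ▸ Set.mem_iUnion.2 ⟨k, s, rfl⟩)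
  have hcut : ∀ k s, cutCurves ζ ξ k s ≠ x := by
    rintro (j | k | k) s
    exacts [hboundary j s, hξx k s, hξx k (-s)]
  -- lifts of the generators of the pieces
  choose v' hv'κ hv'rep hv'1 hv'x using fun i => (τ i).exists_lift hxint (hqx i) hpx hW hsurj (η i)
    fun j s => hcut _ s
  obtain ⟨α, hα⟩ := α
  obtain ⟨β, hβ⟩ := β
  induction α using groupCohomology.H1_induction_on with | h a => ?_
  induction β using groupCohomology.H1_induction_on with | h c => ?_
  have hcoc := fun d : groupCohomology.cocycles₁ (adModule ρ) => (isAdCocycle_cocycles₁ d).comp κ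
  -- The loop around the puncture is an additional boundary generator, so a primitive exists even if
  -- `S` is closed.
  obtain ⟨f, hf⟩ := hpres.exists_isCupPrimitive (hcoc a) (hcoc c)
  have hκrep : ∀ {c γ}, Represents (Set.univ \ {x}) ⟨p, p.2, hpx⟩ c γ →
      Represents Set.univ p c (κ γ) := fun h => h.incl Set.sdiff_subset
  -- local potentials along the boundary curves
  have hpot : ∀ d : groupCohomology.cocycles₁ (adModule ρ),
      groupCohomology.H1π (adModule ρ) d ∈ H1par ρ (curveClasses p (Sum.elim ζ ξ)) →
      ∀ k ∈ Set.range (Sum.map σ.e (id : Fin m ⊕ Fin m → Fin m ⊕ Fin m)), ∀ γ,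
      Represents (Set.univ \ {x}) ⟨p, p.2, hpx⟩ (cutCurves ζ ξ k) γ →
      ∃ X, IsLocalPotential (ρ.comp κ) (d ∘ κ) γ X := by
    rintro d hd _ ⟨y, rfl⟩ γ hγ
    exact exists_isLocalPotential hζ hξ hU σ d hd y (hκrep hγ)
  -- The boundary value becomes a function of the index of the oriented curve. The value `0` is a
  -- mere default for indices without a representative and potential, or not listed by `σ`.
  have hφ : ∀ k, ∃ t : ℝ, ∀ γ X,
      k ∈ Set.range (Sum.map σ.e (id : Fin m ⊕ Fin m → Fin m ⊕ Fin m)) →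
      Represents (Set.univ \ {x}) ⟨p, p.2, hpx⟩ (cutCurves ζ ξ k) γ →
      IsLocalPotential (ρ.comp κ) (a ∘ κ) γ X → f γ - trForm n X ((c ∘ κ) γ) = t := by
    intro k
    by_cases h : ∃ γ X, k ∈ Set.range (Sum.map σ.e (id : Fin m ⊕ Fin m → Fin m ⊕ Fin m)) ∧
      Represents (Set.univ \ {x}) ⟨p, p.2, hpx⟩ (cutCurves ζ ξ k) γ ∧
      IsLocalPotential (ρ.comp κ) (a ∘ κ) γ X
    · obtain ⟨γ₀, X₀, hk, hγ₀, hX₀⟩ := h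
      refine ⟨f γ₀ - trForm n X₀ ((c ∘ κ) γ₀), fun γ X _ hγ hX => ?_⟩
      obtain ⟨g, hg⟩ := hγ₀.exists_conj hγ
      obtain ⟨Y, hY⟩ := hpot c hβ k hk γ hγ
      exact hf.conj_eq (hcoc a) (hcoc c) hg hX₀ hX hY
    · exact ⟨0, fun γ X hk hγ hX => absurd ⟨γ, X, hk, hγ, hX⟩ h⟩
  choose φ hφ using hφ
  have hv'pot := fun d hd i j => hpot d hd _ (e_mem_range σ (τ i) j) _ (hv'rep i j)
  have hκι : ∀ i s, ι i ((τ i).gen s) = κ (v' i s) := fun i s => by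
    rw [hι]
    exact (hv'κ i s).symm
  have hmem : ∀ d : groupCohomology.cocycles₁ (adModule ρ),
      groupCohomology.H1π (adModule ρ) d ∈ H1par ρ (curveClasses p (Sum.elim ζ ξ)) →
      ∀ i, resH1 ρ (ι i) (groupCohomology.H1π (adModule ρ) d) ∈
        H1par (ρ.comp (ι i)) (Set.range fun j => (τ i).gen (Gen.z j)) := by
    intro d hd i
    obtain ⟨d', hd', hres⟩ := resH1_mk (ι i) d
    rw [hres]
    refine mk_mem_H1par_of_isLocalPotential d' ?_
    rintro _ ⟨j, rfl⟩
    -- A potential for the lifted generator serves the generator of the piece, as both have the same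
    -- image in the group of `S`.
    obtain ⟨X, hX⟩ := hv'pot d hd i j
    refine ⟨X, ?_⟩
    unfold IsLocalPotential at hX ⊢
    rw [hd', MonoidHom.comp_apply, hκι]
    exact hX
  refine ⟨hmem a hα, hmem c hβ, ?_⟩
  -- the contribution of the puncture
  have hwlift : FreeGroup.lift gen' (surfaceRelator σ.g σ.b) = w⁻¹ := by
    have h1 := hpres.lift_relator
    rw [lift_addBoundary_surfaceRelator] at h1
    exact eq_inv_of_mul_eq_one_left h1
  have hκlift : ∀ u, κ (FreeGroup.lift gen' u) = FreeGroup.lift σ.gen u := fun u => by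
    rw [← MonoidHom.comp_apply]
    congr 1
    ext s
    simp only [MonoidHom.comp_apply, FreeGroup.lift_apply_of]
    exact hgen' s
  have hκlift' : ∀ i u, κ (FreeGroup.lift (v' i) u) = ι i (FreeGroup.lift (τ i).gen u) :=
    fun i u => by
      rw [← MonoidHom.comp_apply, ← MonoidHom.comp_apply]
      congr 1
      ext s
      simp only [MonoidHom.comp_apply, FreeGroup.lift_apply_of, hκι]
  have hκw : κ w⁻¹ = 1 := by rw [← hwlift, hκlift, σ.presents.lift_relator]
  -- Elements of the kernel of `κ` have potential `0`, so on them the boundary value is `f` itself;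
  -- in particular `f` is invariant under conjugation there.
  have hpot1 : ∀ (d : groupCohomology.cocycles₁ (adModule ρ)) γ, κ γ = 1 →
      IsLocalPotential (ρ.comp κ) (d ∘ κ) γ 0 := fun d γ hγ => by
    unfold IsLocalPotential
    rw [Function.comp_apply, hγ, (isAdCocycle_cocycles₁ d).map_one, map_zero, sub_zero]
  have hpunct : ∀ i, f (FreeGroup.lift (v' i) (surfaceRelator (τ i).g (τ i).b)) =
      if i = i₀ then f w⁻¹ else 0 := by
    intro i
    split_ifs with hi
    · subst hi
      obtain ⟨r', hr', hball', hrep⟩ := hv'x i hi₀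
      have h1 : Represents (Set.univ \ {x}) ⟨p, p.2, hpx⟩ (smallCircle x r) w := by
        have := hw.represents subset_rfl fun s => ⟨trivial, smallCircle_ne hr hball s⟩
        rwa [Pi1.incl_self] at this
      obtain ⟨g, hg⟩ := (smallCircle_represents hr hr' hball hball' h1).exists_conj hrep
      have hg' : FreeGroup.lift (v' i) (surfaceRelator (τ i).g (τ i).b) = g * w⁻¹ * g⁻¹ := by
        rw [← inv_inv (FreeGroup.lift (v' i) _), hg]
        group
      have hκ1 : κ (FreeGroup.lift (v' i) (surfaceRelator (τ i).g (τ i).b)) = 1 := by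
        rw [hκlift', (τ i).presents.lift_relator, map_one]
      have := hf.conj_eq (hcoc a) (hcoc c) hg' (hpot1 a _ hκw) (hpot1 a _ hκ1) (hpot1 c _ hκ1)
      simpa using this
    · rw [hv'1 i fun hx => hi (hU.eq_of_mem hx hi₀)]
      exact hf.map_one (hcoc a)
  -- the pairings of the surface and of the pieces
  have hgenpot : ∀ j, ∃ X, IsLocalPotential (ρ.comp κ) (a ∘ κ) (gen' (Gen.z j)) X := fun j =>
    hpot a hα _ ⟨Sum.inl j, rfl⟩ _ (by
      have := (hper' j).represents subset_rfl fun s => ⟨trivial, hboundary _ s⟩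
      rwa [Pi1.incl_self] at this)
  have hgenrep : ∀ j, Represents (Set.univ \ {x}) ⟨p, p.2, hpx⟩
      (cutCurves ζ ξ (Sum.inl (σ.e j))) (gen' (Gen.z j)) := fun j => by
    have := (hper' j).represents subset_rfl fun s => ⟨trivial, hboundary _ s⟩
    rwa [Pi1.incl_self] at this
  have hσ : omegaK σ.gen ρ
      ⟨groupCohomology.H1π (adModule ρ) a, H1par_anti ρ (σ.range_subset ξ) hα⟩
      ⟨groupCohomology.H1π (adModule ρ) c, H1par_anti ρ (σ.range_subset ξ) hβ⟩ =
        ∑ j, φ (Sum.inl (σ.e j)) - f w⁻¹ := by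
    choose X hX using hgenpot
    rw [omegaK_eq_sum ρ σ.presents.lift_relator _ _ a c rfl rfl (hcoc a) (hcoc c) hf
      (v' := gen') (fun s => congrArg ρ (hgen' s).symm)
      (fun u => congrArg a (hκlift u).symm) (fun u => congrArg c (hκlift u).symm) X hX, hwlift]
    congr 1
    exact Finset.sum_congr rfl fun j _ =>
      hφ _ _ _ ⟨Sum.inl j, rfl⟩ (hgenrep j) (hX j)
  have hτ : ∀ i, omegaK (τ i).gen (ρ.comp (ι i))
      ⟨resH1 ρ (ι i) (groupCohomology.H1π (adModule ρ) a), hmem a hα i⟩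
      ⟨resH1 ρ (ι i) (groupCohomology.H1π (adModule ρ) c), hmem c hβ i⟩ =
        ∑ j, φ ((τ i).e j) - if i = i₀ then f w⁻¹ else 0 := by
    intro i
    choose X hX using hv'pot a hα i
    obtain ⟨a', ha', hresa⟩ := resH1_mk (ι i) a
    obtain ⟨c', hc', hresc⟩ := resH1_mk (ι i) c
    rw [omegaK_eq_sum (ρ.comp (ι i)) (τ i).presents.lift_relator _ _ a' c' hresa.symm hresc.symm
      (hcoc a) (hcoc c) hf (v' := v' i) (fun s => congrArg ρ (hκι i s))
      (fun u => by rw [ha', Function.comp_apply, hκlift'])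
      (fun u => by rw [hc', Function.comp_apply, hκlift']) X hX, hpunct]
    congr 1
    exact Finset.sum_congr rfl fun j _ =>
      hφ _ _ _ (e_mem_range σ (τ i) j) (hv'rep i j) (hX j)
  -- the two sides of a cutting curve cancel
  have hcancel : ∀ k, φ (Sum.inr (Sum.inl k)) + φ (Sum.inr (Sum.inr k)) = 0 := by
    intro k
    have hper := (hξ.simple k).periodic
    -- One loop in the punctured surface represents `ξ k`, and its inverse represents the other
    -- side; this works because the curve avoids `x`.
    obtain ⟨γ, hγ⟩ := exists_represents (W := Set.univ \ {x}) (p := ⟨p, p.2, hpx⟩)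
      (hξ.simple k).smooth.continuous (by simpa using hper 0) (fun s => ⟨trivial, hξx k s⟩)
      (hW.joinedIn _ ⟨trivial, hξx k 0⟩ _ ⟨trivial, hpx⟩)
    obtain ⟨X, hX⟩ := hpot a hα (Sum.inr (Sum.inl k)) ⟨Sum.inr (Sum.inl k), rfl⟩ γ hγ
    have h1 := hφ (Sum.inr (Sum.inl k)) γ X ⟨Sum.inr (Sum.inl k), rfl⟩ hγ hX
    have h2 := hφ (Sum.inr (Sum.inr k)) γ⁻¹ X ⟨Sum.inr (Sum.inr k), rfl⟩ (hγ.reverse hper)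
      (hX.inv (hcoc a))
    rw [hf.inv_sub (hcoc a) (hcoc c) hX] at h2
    linarith
  -- Summed over the pieces, the puncture term survives only at `i₀` and equals the one of the
  -- surface.
  simp only [hσ, hτ, Finset.sum_sub_distrib, sum_boundary_pieces hζ hξ hU σ τ φ, hcancel,
    Finset.sum_const_zero, add_zero, Finset.sum_ite_eq', Finset.mem_univ, if_true]
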